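/- All languages are subsets of $\Sigma^*=\{0,1\}^*$, and a complexity class is any collection of languages. The disjoint union of languages $A,B$ is $A\oplus B=\{x0 : x\in A\}\cup\{x1 : x\in B\}$; a class $\mathcal C$ is closed under disjoint union if $A,B\in\mathcal C$ implies $A\oplus B\in\mathcal C$. Machines are deterministic polynomial-time oracle Turing machines whose polynomial time bound does not depend on the oracles. For complexity classes $\mathcal C,\mathcal D$, let each of the following be the class of all languages $L$ for which there are $C\in\mathcal C$, $D\in\mathcal D$ and such a machine that accepts exactly $L$ with oracles $C$ and $D$ and that, on every input, accesses the oracles as described: * $\mathrm P^{\mathcal C:\mathcal D}$: at most one query to $C$, followed by at most one query to $D$ (hence $\mathrm P^{\mathcal D:\mathcal C}$: at most one query to $D$, followed by at most one query to $C$); * $\mathrm P_{1,1\text{-tt}}^{(\mathcal C,\mathcal D)}$: at most one query to $C$ and at most one query to $D$, made simultaneously; * $\mathrm P^{\mathcal C,\mathcal D}$: at most one query to $C$ and at most one query to $D$, in arbitrary order. Write $A\le_m^{p,\mathcal D[1]}B$ if there is a total function $f$ that is computable in polynomial time with at most one query to some oracle $D\in\mathcal D$, such that for all $x\in\Sigma^*$,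 $x\in A\iff f(x)\in B$. Theorem. Let $\mathcal C$ and $\mathcal D$ be complexity classes such that $\mathcal C$ is closed downwards under $\le_m^{p,\mathcal D[1]}$ (that is, $A\le_m^{p,\mathcal D[1]}B$ and $B\in\mathcal C$ imply $A\in\mathcal C$), and both $\mathcal C$ and $\mathcal D$ are closed under disjoint union. Then $$\mathrm P_{1,1\text{-tt}}^{(\mathcal C,\mathcal D)}=\mathrm P^{\mathcal C:\mathcal D}=\mathrm P^{\mathcal D:\mathcal C}=\mathrm P^{\mathcal C,\mathcal D}.$$ -/

import Mathlib

namespace QueryOrder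

/-- A complexity class: a collection of languages over `{0, 1}` (`false` is `0`, `true` is `1`). -/
abbrev ComplexityClass := Set (Language Bool)

/-- What an oracle machine does in one step, with states `Q`, two-way tapes `K`, oracles `ι`.
* `halt b`: stop, accepting if `b = true` and rejecting otherwise.
* `move`: go to state `next`; on every two-way tape write a symbol and then move the head one cell
  (or leave it in place); append at most one bit to each write-only query tape and to the
  write-only output tape.
* `ask S next`: ask, simultaneously, each of the oracles `i ∈ S` about the word that stands on the
  query tape of `i`; the answers determine the next state and the query tapes used are erased.
  An ordinary query to the oracle `i` is the case `S = {i}`. -/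
inductive Action (Q K ι : Type) where
  | halt (b : Bool)
  | move (next : Q) (write : K → Option Bool) (dir : K → Option Turing.Dir)
      (emit : ι → Option Bool) (out : Option Bool)
  | ask (S : Finset ι) (next : (ι → Bool) → Q)

/-- A deterministic multitape oracle Turing machine with oracles indexed by `ι`. It has finitely
many states and finitely many two-way infinite tapes over `{0, 1, blank}` (`none` is the blank; a
larger tape alphabet amounts to several such tapes whose heads move in parallel), a query tape for
each oracle, and an output tape. The input stands on the tape `inp`. -/
structure OracleTM (ι : Type) where
  State : Type
  Tape : Type
  [finiteState : Finite State]
  [finiteTape : Finite Tape]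
  [decEqTape : DecidableEq Tape]
  inp : Tape
  start : State
  δ : State → (Tape → Option Bool) → Action State Tape ι

attribute [instance] OracleTM.finiteState OracleTM.finiteTape OracleTM.decEqTape

namespace OracleTM

variable {ι : Type} [DecidableEq ι]

/-- Configurations. The component `log` plays no role in the computation: it records, in
chronological order, the sets of oracles that have been asked. -/
structure Cfg (M : OracleTM ι) where
  state : M.State
  tape : M.Tape → Turing.Tape (Option Bool)
  query : ι → List Bool
  out : List Bool
  log : List (Finset ι)

/-- The initial configuration: the head of the input tape is on the first letter of `x`, and all
other tapes are empty. -/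
def init (M : OracleTM ι) (x : List Bool) : M.Cfg where
  state := M.start
  tape k := if k = M.inp then Turing.Tape.mk₁ (x.map some) else default
  query _ := []
  out := []
  log := []

/-- The action that the machine takes in a configuration. -/
def action (M : OracleTM ι) (c : M.Cfg) : Action M.State M.Tape ι :=
  M.δ c.state fun k => (c.tape k).head

open Classical in
/-- The answers to the queries to the oracles in `S` (`false` for the oracles not asked). -/
noncomputable def answers (O : ι → Language Bool) (S : Finset ι) (q : ι → List Bool) (i : ι) :
    Bool :=
  decide (i ∈ S ∧ q i ∈ O i)

/-- One step of the computation with oracles `O`; halting configurations stay unchanged. -/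
noncomputable def step (M : OracleTM ι) (O : ι → Language Bool) (c : M.Cfg) : M.Cfg :=
  match M.action c with
  | .halt _ => c
  | .move next write dir emit out =>
    { state := next
      tape := fun k =>
        match dir k with
        | none => (c.tape k).write (write k)
        | some d => ((c.tape k).write (write k)).move d
      query := fun i => c.query i ++ (emit i).toList
      out := c.out ++ out.toList
      log := c.log }
  | .ask S next =>
    { state := next (answers O S c.query)
      tape := c.tape
      query := fun i => if i ∈ S then [] else c.query i
      out := c.out
      log := c.log ++ [S] }

/-- The configuration after `t` steps on input `x` with oracles `O`. -/
noncomputable def run (M : OracleTM ι) (O : ι → Language Bool) (x : List Bool) (t : ℕ) : M.Cfg :=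
  (M.step O)^[t] (M.init x)

/-- `some b` if the configuration is halting, with verdict `b`; `none` otherwise. -/
def verdict (M : OracleTM ι) (c : M.Cfg) : Option Bool :=
  match M.action c with
  | .halt b => some b
  | _ => none

/-- `M` runs in polynomial time, with a bound that is independent of the oracles. -/
def PolyTime (M : OracleTM ι) : Prop :=
  ∃ p : Polynomial ℕ, ∀ (O : ι → Language Bool) (x : List Bool),
    ∃ t ≤ p.eval x.length, ∃ b, M.verdict (M.run O x t) = some b

/-- The language accepted by `M` with oracles `O`. -/
def accepted (M : OracleTM ι) (O : ι → Language Bool) : Language Bool :=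
  {x : List Bool | ∃ t, M.verdict (M.run O x t) = some true}

/-- `M` with oracles `O` computes the total function `f`. -/
def Computes (M : OracleTM ι) (O : ι → Language Bool) (f : List Bool → List Bool) : Prop :=
  ∀ x, ∃ t b, M.verdict (M.run O x t) = some b ∧ (M.run O x t).out = f x

/-- On every input, the sequence of sets of oracles asked by `M` with oracles `O` obeys `R`
throughout the computation. -/
def Obeys (M : OracleTM ι) (O : ι → Language Bool) (R : List (Finset ι) → Prop) : Prop :=
  ∀ x t, R (M.run O x t).log

end OracleTM

/-- `P^{𝒞 : 𝒟}`: at most one query to `C`, followed by at most one query to `D`. -/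
def POrdered (𝒞 𝒟 : ComplexityClass) : ComplexityClass :=
  {L | ∃ C ∈ 𝒞, ∃ D ∈ 𝒟, ∃ M : OracleTM (Fin 2), M.PolyTime ∧
    M.Obeys ![C, D] (fun l => l.Sublist [{0}, {1}]) ∧ L = M.accepted ![C, D]}

/-- `P_{1,1-tt}^{(𝒞, 𝒟)}`: simultaneously at most one query to `C` and at most one query to `D`,
that is, oracles are asked at most once, and what is asked then is asked at the same time. -/
def PParallel (𝒞 𝒟 : ComplexityClass) : ComplexityClass :=
  {L | ∃ C ∈ 𝒞, ∃ D ∈ 𝒟, ∃ M : OracleTM (Fin 2), M.PolyTime ∧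
    M.Obeys ![C, D] (fun l => l.length ≤ 1) ∧ L = M.accepted ![C, D]}

/-- `P^{𝒞, 𝒟}`: at most one query to `C` and at most one query to `D`, in arbitrary order (the
order may depend on the input). -/
def PUnordered (𝒞 𝒟 : ComplexityClass) : ComplexityClass :=
  {L | ∃ C ∈ 𝒞, ∃ D ∈ 𝒟, ∃ M : OracleTM (Fin 2), M.PolyTime ∧
    M.Obeys ![C, D] (fun l => l.Sublist [{0}, {1}] ∨ l.Sublist [{1}, {0}]) ∧
    L = M.accepted ![C, D]}

/-- `FP^{𝒟[1]}`: the total functions computable in polynomial time with at most one query to some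
member of `𝒟`. -/
def FPOneQuery (𝒟 : ComplexityClass) : Set (List Bool → List Bool) :=
  {f | ∃ D ∈ 𝒟, ∃ M : OracleTM (Fin 1), M.PolyTime ∧
    M.Obeys ![D] (fun l => l.length ≤ 1) ∧ M.Computes ![D] f}

/-- The reducibility `A ≤_m^{p, 𝒟[1]} B`. -/
def ManyOneReduces (𝒟 : ComplexityClass) (A B : Language Bool) : Prop :=
  ∃ f ∈ FPOneQuery 𝒟, ∀ x, x ∈ A ↔ f x ∈ B

/-- `𝒞` is closed downwards under `≤_m^{p, 𝒟[1]}`. -/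
def ClosedDownward (𝒞 𝒟 : ComplexityClass) : Prop :=
  ∀ A B : Language Bool, ManyOneReduces 𝒟 A B → B ∈ 𝒞 → A ∈ 𝒞

/-- The disjoint union `A ⊕ B = {x0 | x ∈ A} ∪ {x1 | x ∈ B}`. -/
def disjointUnion (A B : Language Bool) : Language Bool :=
  {w : List Bool | (∃ x ∈ A, w = x ++ [false]) ∨ (∃ x ∈ B, w = x ++ [true])}

/-- `𝒞` is closed under disjoint union. -/
def ClosedDisjointUnion (𝒞 : ComplexityClass) : Prop :=
  ∀ A ∈ 𝒞, ∀ B ∈ 𝒞, disjointUnion A B ∈ 𝒞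

end QueryOrder

/-!
If the first question of a machine goes to `C`, its verdict is a function of the answer that takes
only one further query to `D` to evaluate at each of the two possible answers. If the function is
constant, the answer is irrelevant; otherwise it is the identity or the negation. Comparing the
verdict under a fixed guess with the knowledge whether the guess is right, when this matters, thus
determines the true verdict with one query to `D`, and this query does not depend on the answer of
`C`. The remaining question, namely the one that the machine asks to `C`, replaced by a fixed word
when the answer does not matter, is composed of three reductions with one query to `D` each: the two
verdicts, and the query itself, which may depend on an earlier answer of `D`. So it defines a
language in `𝒞`, and it can be asked simultaneously with the query to `D`. Conversely, two
simultaneous queries can be made one after the other, in either order.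
-/

open Turing (Dir Tape ListBlank)

namespace QueryOrder

theorem polynomial_eval_mono (p : Polynomial ℕ) {m n : ℕ} (h : m ≤ n) : p.eval m ≤ p.eval n := by
  induction p using Polynomial.induction_on' with
  | add p q hp hq => simpa only [Polynomial.eval_add] using Nat.add_le_add hp hq
  | monomial k a =>
    simp only [Polynomial.eval_monomial]
    exact Nat.mul_le_mul_left _ (Nat.pow_le_pow_left h k)

open Classical in
/-- The Boolean characteristic function of a language, that is, the answers of an oracle. -/
noncomputable def indicator (L : Language Bool) (w : List Bool) : Bool :=
  decide (w ∈ L)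

theorem indicator_eq_true {L : Language Bool} {w : List Bool} : indicator L w = true ↔ w ∈ L := by
  simp [indicator]

/-- The oracles that give the constant answers `E`. -/
def constOracle {ι : Type} (E : ι → Bool) (i : ι) : Language Bool :=
  {_w : List Bool | E i = true}

theorem indicator_constOracle {ι : Type} (E : ι → Bool) (i : ι) (w : List Bool) :
    indicator (constOracle E i) w = E i := by
  rw [Bool.eq_iff_iff, indicator_eq_true]
  rfl

namespace OracleTM

section Actions

variable {ι : Type} (M : OracleTM ι) {c : M.Cfg}

/-- The set of oracles that `M` asks in the configuration `c`, if it asks any. -/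
def asks (c : M.Cfg) : Option (Finset ι) :=
  match M.action c with
  | .ask S _ => some S
  | _ => none

/-- The machine neither asks nor halts in the configuration `c`. -/
def IsMove (c : M.Cfg) : Prop :=
  M.verdict c = none ∧ M.asks c = none

variable {M}

theorem isMove_iff : M.IsMove c ↔
    ∃ next write dir emit out, M.action c = .move next write dir emit out := by
  unfold IsMove verdict asks
  cases M.action c <;> simp

theorem verdict_eq_some {b : Bool} : M.verdict c = some b ↔ M.action c = .halt b := by
  unfold verdict
  cases M.action c <;> simp

theorem asks_eq_some {S : Finset ι} : M.asks c = some S ↔ ∃ next, M.action c = .ask S next := by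
  unfold asks
  cases M.action c <;> simp

theorem verdict_eq_none_of_asks {S : Finset ι} (h : M.asks c = some S) : M.verdict c = none := by
  obtain ⟨next, h⟩ := asks_eq_some.1 h
  simp [verdict, h]

end Actions

section Steps

variable {ι : Type} [DecidableEq ι] (M : OracleTM ι)

/-- The configuration that follows `c` when the oracles asked in `c` give the answers `a`; a
configuration without queries is left unchanged. -/
def reply (c : M.Cfg) (a : ι → Bool) : M.Cfg :=
  match M.action c with
  | .ask S next =>
    { state := next fun i => decide (i ∈ S) && a i
      tape := c.tape
      query := fun i => if i ∈ S then [] else c.query i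
      out := c.out
      log := c.log ++ [S] }
  | _ => c

/-- One step with the empty oracles. It is used in configurations without queries, where the
oracles do not matter. -/
noncomputable def advance (c : M.Cfg) : M.Cfg :=
  M.step (fun _ => (∅ : Set (List Bool))) c

variable {M} {c : M.Cfg} {S : Finset ι} {O : ι → Language Bool}

theorem reply_log (h : M.asks c = some S) (a : ι → Bool) :
    (M.reply c a).log = c.log ++ [S] := by
  obtain ⟨next, h⟩ := asks_eq_some.1 h
  simp [reply, h]

theorem reply_query (h : M.asks c = some S) (a : ι → Bool) (i : ι) :
    (M.reply c a).query i = if i ∈ S then [] else c.query i := by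
  obtain ⟨next, h⟩ := asks_eq_some.1 h
  simp [reply, h]

theorem reply_congr (h : M.asks c = some S) {a b : ι → Bool} (hab : ∀ i ∈ S, a i = b i) :
    M.reply c a = M.reply c b := by
  obtain ⟨next, h⟩ := asks_eq_some.1 h
  have : (fun i => decide (i ∈ S) && a i) = fun i => decide (i ∈ S) && b i := by
    funext i
    by_cases hi : i ∈ S <;> simp [hi, hab]
  simp [reply, h, this]

theorem answers_of_mem {q : ι → List Bool} {i : ι} (hi : i ∈ S) :
    answers O S q i = indicator (O i) (q i) := by
  simp [answers, indicator, hi]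

theorem step_of_asks (h : M.asks c = some S) :
    M.step O c = M.reply c fun i => indicator (O i) (c.query i) := by
  obtain ⟨next, h⟩ := asks_eq_some.1 h
  have : answers O S c.query = fun i => decide (i ∈ S) && indicator (O i) (c.query i) := by
    funext i
    by_cases hi : i ∈ S
    · simp [answers_of_mem, hi]
    · simp [answers, hi]
  simp [step, reply, h, this]

theorem step_of_verdict {b : Bool} (h : M.verdict c = some b) : M.step O c = c := by
  rw [verdict_eq_some] at h
  simp [step, h]

theorem step_of_isMove (h : M.IsMove c) : M.step O c = M.advance c := by
  obtain ⟨_, _, _, _, _, h⟩ := isMove_iff.1 h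
  simp [advance, step, h]

theorem iterate_step_of_verdict {b : Bool} (h : M.verdict c = some b) (n : ℕ) :
    (M.step O)^[n] c = c :=
  Function.iterate_fixed (step_of_verdict h) n

theorem advance_log (h : M.IsMove c) : (M.advance c).log = c.log := by
  obtain ⟨_, _, _, _, _, h⟩ := isMove_iff.1 h
  simp [advance, step, h]

theorem advance_query_prefix (h : M.IsMove c) (i : ι) : c.query i <+: (M.advance c).query i := by
  obtain ⟨_, _, _, _, _, h⟩ := isMove_iff.1 h
  simp [advance, step, h]

theorem log_prefix_step (O : ι → Language Bool) (c : M.Cfg) : c.log <+: (M.step O c).log := by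
  unfold step
  cases M.action c <;> simp

theorem log_prefix_iterate_step (O : ι → Language Bool) (c : M.Cfg) (n : ℕ) :
    c.log <+: ((M.step O)^[n] c).log := by
  induction n with
  | zero => exact List.prefix_rfl
  | succ n ih =>
    rw [Function.iterate_succ_apply']
    exact ih.trans (log_prefix_step O _)

end Steps

section Pause

variable {ι : Type} [DecidableEq ι] (M : OracleTM ι) (c : M.Cfg)

/-- The number of steps from `c` to the next query, or to halting (the junk value of `sInf ∅` is
`0` if the machine neither asks nor halts). -/
noncomputable def pauseTime : ℕ :=
  sInf {n | ¬ M.IsMove (M.advance^[n] c)}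

/-- The first configuration from `c` on in which the machine asks or halts. -/
noncomputable def pause : M.Cfg :=
  M.advance^[M.pauseTime c] c

/-- What is appended to the query tape of `i` during the first `n` steps from `c`, for
`n ≤ M.pauseTime c`. -/
noncomputable def emitted (n : ℕ) (i : ι) : List Bool :=
  ((M.advance^[n] c).query i).drop (c.query i).length

variable {M c} {O : ι → Language Bool}

theorem isMove_of_lt_pauseTime {n : ℕ} (h : n < M.pauseTime c) :
    M.IsMove (M.advance^[n] c) := by
  by_contra hn
  exact Nat.notMem_of_lt_sInf h hn

theorem iterate_step_of_isMove {n : ℕ} (h : ∀ j < n, M.IsMove (M.advance^[j] c)) :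
    (M.step O)^[n] c = M.advance^[n] c := by
  induction n with
  | zero => rfl
  | succ n ih =>
    rw [Function.iterate_succ_apply', Function.iterate_succ_apply',
      ih fun j hj => h j (by omega), step_of_isMove (h n (by omega))]

theorem iterate_step_pauseTime (O : ι → Language Bool) (c : M.Cfg) :
    (M.step O)^[M.pauseTime c] c = M.pause c :=
  iterate_step_of_isMove fun _ => isMove_of_lt_pauseTime

theorem pauseTime_pause (c : M.Cfg) : M.pauseTime (M.pause c) = 0 := by
  rcases Set.eq_empty_or_nonempty {n | ¬ M.IsMove (M.advance^[n] c)} with hempty | hne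
  · have hzero : M.pauseTime c = 0 := Nat.sInf_eq_zero.2 (.inr hempty)
    rw [pause, hzero, Function.iterate_zero_apply, hzero]
  · exact Nat.sInf_eq_zero.2 (.inl (Nat.sInf_mem hne))

theorem pause_pause (c : M.Cfg) : M.pause (M.pause c) = M.pause c := by
  rw [pause, pauseTime_pause, Function.iterate_zero_apply]

theorem pauseTime_le_and_not_isMove {t : ℕ} {b : Bool}
    (hb : M.verdict ((M.step O)^[t] c) = some b) :
    M.pauseTime c ≤ t ∧ ¬ M.IsMove (M.pause c) := by
  have key : M.pauseTime c ≤ t ∧ {n | ¬ M.IsMove (M.advance^[n] c)}.Nonempty := by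
    by_contra hcon
    have hall : ∀ j ≤ t, M.IsMove (M.advance^[j] c) := by
      intro j hj
      by_contra hn
      exact hcon ⟨(Nat.sInf_le hn).trans hj, ⟨j, hn⟩⟩
    rw [iterate_step_of_isMove fun j hj => hall j hj.le] at hb
    simp [(hall t le_rfl).1] at hb
  exact ⟨key.1, Nat.sInf_mem key.2⟩

theorem iterate_advance_log {n : ℕ} (hn : n ≤ M.pauseTime c) :
    (M.advance^[n] c).log = c.log := by
  induction n with
  | zero => rfl
  | succ n ih =>
    rw [Function.iterate_succ_apply', advance_log (isMove_of_lt_pauseTime hn), ih (by omega)]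

theorem pause_log (c : M.Cfg) : (M.pause c).log = c.log :=
  iterate_advance_log le_rfl

theorem query_append_emitted {n : ℕ} (hn : n ≤ M.pauseTime c) (i : ι) :
    c.query i ++ M.emitted c n i = (M.advance^[n] c).query i := by
  suffices c.query i <+: (M.advance^[n] c).query i by
    obtain ⟨u, hu⟩ := this
    simp [emitted, ← hu]
  induction n with
  | zero => exact List.prefix_rfl
  | succ n ih =>
    rw [Function.iterate_succ_apply']
    exact (ih (by omega)).trans (advance_query_prefix (isMove_of_lt_pauseTime hn) i)

end Pause

section Halting

variable {ι : Type} [DecidableEq ι] (M : OracleTM ι)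

/-- From `c`, the machine halts within `T` steps, and its verdict, output and log satisfy `Q`. -/
def HaltsWith (O : ι → Language Bool) (T : ℕ) (Q : Bool → List Bool → List (Finset ι) → Prop)
    (c : M.Cfg) : Prop :=
  ∃ t ≤ T, ∃ b, M.verdict ((M.step O)^[t] c) = some b ∧
    Q b ((M.step O)^[t] c).out ((M.step O)^[t] c).log

variable {M} {O : ι → Language Bool} {T : ℕ} {Q : Bool → List Bool → List (Finset ι) → Prop}
  {c : M.Cfg}

theorem HaltsWith.mono {T' : ℕ} (h : M.HaltsWith O T Q c) (hT : T ≤ T') :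
    M.HaltsWith O T' Q c := by
  obtain ⟨t, ht, h⟩ := h
  exact ⟨t, ht.trans hT, h⟩

theorem HaltsWith.of_iterate {n : ℕ} (h : M.HaltsWith O T Q ((M.step O)^[n] c)) :
    M.HaltsWith O (T + n) Q c := by
  obtain ⟨t, ht, h⟩ := h
  refine ⟨t + n, by omega, ?_⟩
  rwa [Function.iterate_add_apply]

theorem HaltsWith.iterate {n : ℕ} (h : M.HaltsWith O T Q c) :
    M.HaltsWith O (T - n) Q ((M.step O)^[n] c) := by
  obtain ⟨t, ht, b, hb, hQ⟩ := h
  rcases le_total n t with hnt | htn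
  · refine ⟨t - n, by omega, b, ?_⟩
    rw [← Function.iterate_add_apply, Nat.sub_add_cancel hnt]
    exact ⟨hb, hQ⟩
  · obtain ⟨d, rfl⟩ := Nat.exists_eq_add_of_le' htn
    refine ⟨0, by omega, b, ?_⟩
    rw [Function.iterate_zero_apply, Function.iterate_add_apply, iterate_step_of_verdict hb]
    exact ⟨hb, hQ⟩

theorem HaltsWith.pauseTime_le (h : M.HaltsWith O T Q c) : M.pauseTime c ≤ T := by
  obtain ⟨t, ht, b, hb, -⟩ := h
  exact (pauseTime_le_and_not_isMove hb).1.trans ht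

theorem HaltsWith.not_isMove_pause (h : M.HaltsWith O T Q c) : ¬ M.IsMove (M.pause c) := by
  obtain ⟨t, -, b, hb, -⟩ := h
  exact (pauseTime_le_and_not_isMove hb).2

end Halting

section Live

variable {ι : Type} [DecidableEq ι] (M : OracleTM ι)

/-- From `c`, the machine halts within `T` steps whatever answers it is given from now on, as
long as each oracle is answered consistently. The answers `A` are those given so far. -/
def Live (T : ℕ) (c : M.Cfg) : Prop :=
  ∃ A : ι → Bool, ∀ E : ι → Bool, (∀ S ∈ c.log, ∀ i ∈ S, E i = A i) →
    M.HaltsWith (constOracle E) T (fun _ _ _ => True) c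

variable {M} {T : ℕ} {c : M.Cfg}

theorem Live.haltsWith (h : M.Live T c) :
    ∃ E, M.HaltsWith (constOracle E) T (fun _ _ _ => True) c :=
  let ⟨A, hA⟩ := h
  ⟨A, hA A fun _ _ _ _ => rfl⟩

theorem Live.pause (h : M.Live T c) : M.Live (T - M.pauseTime c) (M.pause c) := by
  obtain ⟨A, hA⟩ := h
  refine ⟨A, fun E hE => ?_⟩
  rw [pause_log] at hE
  simpa only [iterate_step_pauseTime] using (hA E hE).iterate (n := M.pauseTime c)

theorem Live.reply {S : Finset ι} (h : M.Live T c) (hS : M.asks c = some S)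
    (hfresh : ∀ S' ∈ c.log, Disjoint S' S) (a : ι → Bool) :
    M.Live (T - 1) (M.reply c a) := by
  obtain ⟨A, hA⟩ := h
  refine ⟨fun i => if i ∈ S then a i else A i, fun E hE => ?_⟩
  simp only [reply_log hS, List.mem_append, List.mem_singleton] at hE
  have hEA : ∀ S' ∈ c.log, ∀ i ∈ S', E i = A i := fun S' hS' i hi => by
    simpa [Finset.disjoint_left.1 (hfresh S' hS') hi] using hE S' (.inl hS') i hi
  have hstep : M.step (constOracle E) c = M.reply c a := by
    simp only [step_of_asks hS, indicator_constOracle]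
    exact reply_congr hS fun i hi => by simpa [hi] using hE S (.inr rfl) i hi
  simpa only [Function.iterate_one, hstep] using (hA E hEA).iterate (n := 1)

theorem Live.not_isMove_pause (h : M.Live T c) : ¬ M.IsMove (M.pause c) :=
  let ⟨_, hE⟩ := h.haltsWith
  hE.not_isMove_pause

theorem Live.pauseTime_le (h : M.Live T c) : M.pauseTime c ≤ T :=
  let ⟨_, hE⟩ := h.haltsWith
  hE.pauseTime_le

end Live

end OracleTM

section Tape

variable {Γ : Type*} [Inhabited Γ]

theorem tape_move_left_mk₂ (L R : List Γ) :
    (Tape.mk₂ L R).move .left = Tape.mk₂ L.tail (L.headI :: R) := by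
  simp [Tape.mk₂]

theorem tape_move_right_mk₂ (L R : List Γ) :
    (Tape.mk₂ L R).move .right = Tape.mk₂ (R.headI :: L) R.tail := by
  simp [Tape.mk₂]

theorem tape_head_mk₂ (L R : List Γ) : (Tape.mk₂ L R).head = R.headI := by
  simp [Tape.mk₂]

theorem tape_write_default_mk₂_singleton (L : List Γ) (a : Γ) :
    (Tape.mk₂ L [a]).write default = Tape.mk₂ L [] := by
  have : ListBlank.cons default (ListBlank.mk []) = ListBlank.mk ([] : List Γ) := by
    simpa using ListBlank.cons_head_tail (ListBlank.mk ([] : List Γ))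
  simp [Tape.mk₂, ← ListBlank.cons_mk, Tape.write_mk', this]

end Tape

/-- What a controller does when the machine that it controls asks or halts.
* `feed a next`: resume the machine with the answers `a`.
* `query S next`: ask the own oracles in `S`, then reconsider the same configuration.
* `output b`: append `b` to the output and accept.
* `halt b`: stop with verdict `b`. -/
inductive Command (K ι ι' : Type) where
  | feed (a : ι → Bool) (next : K)
  | query (S : Finset ι') (next : (ι' → Bool) → K)
  | output (b : Bool)
  | halt (b : Bool)

/-- A finite control, with phases `K` and oracles `ι'`, that runs a machine with oracles `ι` on the
input, without its last letter if `strip` is true, and supplies the answers to the queries of that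
machine. The input of the machine is first copied to the query tapes `o` with `copyQuery o`, and
to the output tape if `copyOut` is true. The first phase is `start b`, where `b` is the last letter
of the input. Later on, what the machine writes on the query tape of `i` is appended to the query
tapes `o` with `source o = some i`, and also to the output tape in the phases `k` with
`outSource k = some i`. -/
structure Controller (K ι ι' : Type) where
  strip : Bool
  copyQuery : ι' → Bool
  copyOut : Bool
  onAsk : K → Finset ι → Command K ι ι'
  onHalt : K → Bool → Command K ι ι'
  start : Option Bool → K
  source : ι' → Option ι
  outSource : K → Option ι

/-- The states of a controlled machine in which the controlled machine is not running: `scan b`,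
`turn b`, and `back b` prepare the input, where `b` is the last letter read. While the head moves
to the right, letters are copied with a delay of one step, because the last one may have to be
omitted. -/
inductive Stage where
  | scan (b : Option Bool)
  | turn (b : Bool)
  | back (b : Bool)
  | accept
  deriving Fintype

namespace OracleTM

variable {ι ι' K : Type} (M : OracleTM ι) (P : Controller K ι ι') (read : M.Tape → Option Bool)

/-- The action that moves the head of the input tape in the direction `d`, after erasing its cell
if `erase` is true, and copies the letter `b` to where the input has to be copied. -/
def prepareAction (next : Stage ⊕ M.State × K) (erase : Bool)
    (d : Option Dir) (b : Option Bool) : Action (Stage ⊕ M.State × K) M.Tape ι' :=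
  .move next (fun k => if k = M.inp ∧ erase then none else read k)
    (fun k => if k = M.inp then d else none) (fun o => if P.copyQuery o then b else none)
    (if P.copyOut then b else none)

/-- The transition function of a controlled machine while the input is prepared. -/
def prepare : Stage → Action (Stage ⊕ M.State × K) M.Tape ι'
  | .accept => .halt true
  | .scan b =>
    match read M.inp, b with
    | some a, b => M.prepareAction P read (.inl (.scan (some a))) false (some .right) b
    | none, none => M.prepareAction P read (.inr (M.start, P.start none)) false none none
    | none, some b => M.prepareAction P read (.inl (.turn b)) false (some .left) none
  | .turn b =>
    M.prepareAction P read (.inl (.back b)) P.strip (some .left) (if P.strip then none else some b)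
  | .back b =>
    match read M.inp with
    | some _ => M.prepareAction P read (.inl (.back b)) false (some .left) none
    | none => M.prepareAction P read (.inr (M.start, P.start (some b))) false (some .right) none

/-- The action by which a controlled machine executes a command, where `q` is the state of the
machine under control and `resume a` the state reached from `q` with the answers `a`. -/
def commandAction (q : M.State) (resume : (ι → Bool) → M.State) :
    Command K ι ι' → Action (Stage ⊕ M.State × K) M.Tape ι'
  | .feed a next => .move (.inr (resume a, next)) read (fun _ => none) (fun _ => none) none
  | .query S next => .ask S fun a => .inr (q, next a)
  | .output b => .move (.inl .accept) read (fun _ => none) (fun _ => none) (some b)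
  | .halt b => .halt b

variable [DecidableEq ι] [Finite K]

/-- The machine `M` under the control of `P`. -/
def control : OracleTM ι' where
  State := Stage ⊕ M.State × K
  Tape := M.Tape
  inp := M.inp
  start := .inl (.scan none)
  δ
    | .inl st, read => M.prepare P read st
    | .inr (q, k), read =>
      match M.δ q read with
      | .move next write dir emit _ =>
        .move (.inr (next, k)) write dir (fun o => (P.source o).bind emit)
          ((P.outSource k).bind emit)
      | .ask S next =>
        M.commandAction read q (fun a => next fun i => decide (i ∈ S) && a i) (P.onAsk k S)
      | .halt b => M.commandAction read q (fun _ => q) (P.onHalt k b)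

end OracleTM

/-- A configuration of a controlled machine after the preparation of the input: the phase of the
controller, the configuration `sim` of the machine under control, the query tapes and the output
tape of the whole, and its log. The words on the query tapes and on the output tape of `sim` are
not stored anywhere. -/
structure Session {ι : Type} (M : OracleTM ι) (K ι' : Type) where
  phase : K
  sim : M.Cfg
  query : ι' → List Bool
  out : List Bool
  log : List (Finset ι')

namespace Controller

variable {K ι ι' : Type} (P : Controller K ι ι') {M : OracleTM ι}

/-- The input of the machine under control. -/
def input (w : List Bool) : List Bool :=
  if P.strip then w.dropLast else w

theorem length_input_le (w : List Bool) :
    (P.input w).length ≤ w.length := by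
  unfold input
  split_ifs <;> simp

/-- The session in which the machine under control starts to run. -/
def initial (M : OracleTM ι) (w : List Bool) : Session M K ι' where
  phase := P.start w.getLast?
  sim := M.init (P.input w)
  query o := if P.copyQuery o then P.input w else []
  out := if P.copyOut then P.input w else []
  log := []

/-- The command given in a session in which the machine under control asks or halts. -/
def command (s : Session M K ι') : Command K ι ι' :=
  match M.asks s.sim with
  | some S => P.onAsk s.phase S
  | none => P.onHalt s.phase ((M.verdict s.sim).getD false)

variable [DecidableEq ι]

/-- The configuration of the controlled machine in a session. -/
def cfg [Finite K] (s : Session M K ι') : (M.control P).Cfg where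
  state := .inr (s.sim.state, s.phase)
  tape := s.sim.tape
  query := s.query
  out := s.out
  log := s.log

/-- The session after `n` steps, provided that the machine under control neither asks nor halts
before. -/
noncomputable def moved (s : Session M K ι') (n : ℕ) : Session M K ι' where
  phase := s.phase
  sim := M.advance^[n] s.sim
  query o := s.query o ++ (P.source o).elim [] (M.emitted s.sim n)
  out := s.out ++ (P.outSource s.phase).elim [] (M.emitted s.sim n)
  log := s.log

/-- The session when the machine under control asks or halts for the next time. -/
noncomputable def pause (s : Session M K ι') : Session M K ι' :=
  P.moved s (M.pauseTime s.sim)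

end Controller

namespace Session

variable {K ι ι' : Type} {M : OracleTM ι}

/-- The session after the command `Command.feed a next`. -/
def feed [DecidableEq ι] (s : Session M K ι') (a : ι → Bool) (next : K) : Session M K ι' :=
  { s with phase := next, sim := M.reply s.sim a }

/-- The session after the command `Command.query S next`. -/
noncomputable def ask [DecidableEq ι'] (s : Session M K ι') (O : ι' → Language Bool)
    (S : Finset ι') (next : (ι' → Bool) → K) : Session M K ι' :=
  { s with
    phase := next (OracleTM.answers O S s.query)
    query := fun o => if o ∈ S then [] else s.query o
    log := s.log ++ [S] }

end Session

section Ensures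

variable {K ι ι' : Type} [DecidableEq ι] [DecidableEq ι'] {M : OracleTM ι}

/-- The command `cmd`, given in the session `s`, supplies no second answer for any oracle, and it
leads to a session that satisfies `E` or, if it is final, to a verdict, an output and a log that
satisfy `Q`. -/
def Command.Ensures (E : Session M K ι' → Prop) (O : ι' → Language Bool)
    (Q : Bool → List Bool → List (Finset ι') → Prop) (s : Session M K ι') : Command K ι ι' → Prop
  | .feed a next =>
    (∃ S, M.asks s.sim = some S ∧ ∀ S' ∈ s.sim.log, Disjoint S' S) ∧ E (s.feed a next)
  | .query S next => E (s.ask O S next)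
  | .output b => Q true (s.out ++ [b]) s.log
  | .halt b => Q b s.out s.log

/-- From the session `s`, the machine controlled by `P` halts after at most `n` commands, `P` never
supplies two answers for the same oracle, and the verdict, the output and the log satisfy `Q`. -/
def Controller.Ensures (P : Controller K ι ι') (O : ι' → Language Bool)
    (Q : Bool → List Bool → List (Finset ι') → Prop) : ℕ → Session M K ι' → Prop
  | 0, _ => False
  | n + 1, s => (P.command (P.pause s)).Ensures (P.Ensures O Q n) O Q (P.pause s)

end Ensures

namespace OracleTM

theorem emitted_succ {ι : Type} [DecidableEq ι] {M : OracleTM ι} {c : M.Cfg} {n : ℕ}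
    (hn : n < M.pauseTime c) {next : M.State} {write : M.Tape → Option Bool}
    {dir : M.Tape → Option Dir} {emit : ι → Option Bool} {out : Option Bool}
    (h : M.action (M.advance^[n] c) = .move next write dir emit out) (i : ι) :
    M.emitted c (n + 1) i = M.emitted c n i ++ (emit i).toList := by
  apply List.append_cancel_left (as := c.query i)
  rw [query_append_emitted hn, ← List.append_assoc, query_append_emitted hn.le,
    Function.iterate_succ_apply']
  simp [advance, step, h]

end OracleTM

namespace Controller

open OracleTM

variable {K ι ι' : Type} [DecidableEq ι] [Finite K] {P : Controller K ι ι'} {M : OracleTM ι}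

theorem action_cfg (P : Controller K ι ι') {s : Session M K ι'}
    (h : ¬ M.IsMove s.sim) :
    (M.control P).action (P.cfg s) = M.commandAction (fun k => (s.sim.tape k).head)
      s.sim.state (fun a => (M.reply s.sim a).state) (P.command s) := by
  cases hact : M.action s.sim with
  | move => exact absurd (isMove_iff.2 ⟨_, _, _, _, _, hact⟩) h
  | halt b =>
    have hδ := hact
    rw [action] at hδ
    simp [action, OracleTM.control, cfg, command, asks, verdict, reply, hδ]
  | ask S next =>
    have hδ := hact
    rw [action] at hδ
    simp [action, OracleTM.control, cfg, command, asks, reply, hδ]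

variable [DecidableEq ι'] {O : ι' → Language Bool} {s : Session M K ι'}

theorem iterate_step_cfg {n : ℕ} (hn : n ≤ M.pauseTime s.sim) :
    ((M.control P).step O)^[n] (P.cfg s) = P.cfg (P.moved s n) := by
  induction n with
  | zero =>
    have hemit (i : Option ι) : i.elim [] (M.emitted s.sim 0) = [] := by
      cases i <;> simp [emitted]
    simp [moved, hemit]
  | succ n ih =>
    obtain ⟨next, write, dir, emit, out, h⟩ := isMove_iff.1 (isMove_of_lt_pauseTime hn)
    have hemit (i : Option ι) : i.elim [] (M.emitted s.sim (n + 1)) =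
        i.elim [] (M.emitted s.sim n) ++ (i.bind emit).toList := by
      cases i <;> simp [emitted_succ hn h]
    have hact : (M.control P).action (P.cfg (P.moved s n)) = .move (.inr (next, s.phase)) write
        dir (fun o => (P.source o).bind emit) ((P.outSource s.phase).bind emit) := by
      simp only [action] at h
      simp [action, OracleTM.control, cfg, moved, h]
    rw [Function.iterate_succ_apply', ih (by omega), step, hact]
    simp only [cfg, moved, hemit, Function.iterate_succ_apply', advance, step, h, List.append_assoc]
    rfl

theorem iterate_step_cfg_pauseTime (s : Session M K ι') :
    ((M.control P).step O)^[M.pauseTime s.sim] (P.cfg s) = P.cfg (P.pause s) :=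
  iterate_step_cfg le_rfl

theorem step_cfg_of_feed (h : ¬ M.IsMove s.sim) {a : ι → Bool} {next : K}
    (hcmd : P.command s = .feed a next) :
    (M.control P).step O (P.cfg s) = P.cfg (s.feed a next) := by
  have htape : (M.reply s.sim a).tape = s.sim.tape := by
    unfold reply
    cases M.action s.sim <;> rfl
  simp only [step, action_cfg P h, hcmd, commandAction]
  simp [cfg, Session.feed, htape, Tape.write_self]

theorem step_cfg_of_query (h : ¬ M.IsMove s.sim) {S : Finset ι'} {next : (ι' → Bool) → K}
    (hcmd : P.command s = .query S next) :
    (M.control P).step O (P.cfg s) = P.cfg (s.ask O S next) := by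
  simp only [step, action_cfg P h, hcmd, commandAction]
  rfl

theorem haltsWith_of_ensures {Q : Bool → List Bool → List (Finset ι') → Prop} {n T : ℕ}
    (hlive : M.Live T s.sim) (h : P.Ensures O Q n s) :
    (M.control P).HaltsWith O (T + n) Q (P.cfg s) := by
  induction n generalizing s T with
  | zero => exact h.elim
  | succ n ih =>
    have hT : T - M.pauseTime s.sim + (n + 1) + M.pauseTime s.sim ≤ T + (n + 1) := by
      have := hlive.pauseTime_le
      omega
    refine HaltsWith.mono (HaltsWith.of_iterate ?_) hT
    rw [iterate_step_cfg_pauseTime]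
    have hmove : ¬ M.IsMove (P.pause s).sim := hlive.not_isMove_pause
    have hlive' : M.Live (T - M.pauseTime s.sim) (P.pause s).sim := hlive.pause
    rw [Ensures] at h
    cases hcmd : P.command (P.pause s) with rw [hcmd] at h
    | feed a next =>
      obtain ⟨⟨S, hS, hfresh⟩, h⟩ := h
      refine HaltsWith.of_iterate (n := 1) (T := T - M.pauseTime s.sim + n) ?_
      rw [Function.iterate_one, step_cfg_of_feed hmove hcmd]
      exact (ih (hlive'.reply hS hfresh _) h).mono (by omega)
    | query S next =>
      refine HaltsWith.of_iterate (n := 1) (T := T - M.pauseTime s.sim + n) ?_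
      rw [Function.iterate_one, step_cfg_of_query hmove hcmd]
      exact ih hlive' h
    | output b =>
      refine ⟨1, by omega, true, ?_⟩
      simp only [Function.iterate_one, step, action_cfg P hmove, hcmd, commandAction]
      exact ⟨rfl, h⟩
    | halt b =>
      refine ⟨0, by omega, b, verdict_eq_some.2 ?_, h⟩
      rw [Function.iterate_zero_apply, action_cfg P hmove, hcmd]
      rfl

end Controller

namespace Controller

open OracleTM

section Preparation

variable {K ι ι' : Type} [DecidableEq ι] [Finite K] (P : Controller K ι ι') {M : OracleTM ι}

/-- The configuration of a controlled machine, during the preparation of the input, in the state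
`q`, with input tape `t`, after the word `u` has been copied. -/
def prepareCfg (q : Stage ⊕ M.State × K) (t : Tape (Option Bool)) (u : List Bool) :
    (M.control P).Cfg where
  state := q
  tape := fun k : M.Tape => if k = M.inp then t else default
  query o := if P.copyQuery o then u else []
  out := if P.copyOut then u else []
  log := []

theorem prepareCfg_eq_cfg_initial (M : OracleTM ι) (w : List Bool) :
    P.prepareCfg (.inr (M.start, P.start w.getLast?)) (Tape.mk₁ ((P.input w).map some))
      (P.input w) = P.cfg (P.initial M w) :=
  rfl

variable {P} [DecidableEq ι'] {O : ι' → Language Bool} {q : Stage ⊕ M.State × K}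
  {t : Tape (Option Bool)} {u : List Bool}

theorem step_prepareCfg {st : Stage} {erase : Bool} {d : Option Dir} {b : Option Bool}
    (h : ∀ read : M.Tape → Option Bool, read M.inp = t.head →
      M.prepare P read st = M.prepareAction P read q erase d b) :
    (M.control P).step O (P.prepareCfg (.inl st) t u) =
      P.prepareCfg q (d.elim id Tape.move (if erase then t.write none else t)) (u ++ b.toList) := by
  have hact : (M.control P).action (P.prepareCfg (.inl st) t u) =
      M.prepareAction P (fun k => (if k = M.inp then t else default).head) q erase d b :=
    h (fun k => (if k = M.inp then t else default).head) (by simp)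
  have hquery (f : Bool) : (if f then u else []) ++ (if f then b else none).toList =
      if f then u ++ b.toList else [] := by
    cases f <;> rfl
  simp only [step, hact, prepareAction]
  simp only [prepareCfg, hquery]
  congr 1
  funext (k : M.Tape)
  by_cases hk : k = M.inp <;> cases d <;> cases erase <;> simp [hk, Tape.write_self]

theorem iterate_step_scan (v rest : List Bool) :
    ((M.control P).step O)^[rest.length]
        (P.prepareCfg (.inl (.scan v.getLast?)) (Tape.mk₂ (v.map some).reverse (rest.map some))
          v.dropLast) =
      P.prepareCfg (.inl (.scan (v ++ rest).getLast?)) (Tape.mk₂ ((v ++ rest).map some).reverse [])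
        (v ++ rest).dropLast := by
  induction rest generalizing v with
  | nil => simp
  | cons a rest ih =>
    have hv : v.dropLast ++ v.getLast?.toList = v := by
      rcases v.eq_nil_or_concat with rfl | ⟨v, a, rfl⟩ <;> simp
    rw [List.length_cons, Function.iterate_succ_apply,
      step_prepareCfg (q := .inl (.scan (some a))) (erase := false) (d := some .right)
        (b := v.getLast?) (fun read hread => by simp [prepare, hread, tape_head_mk₂]), hv]
    simpa [tape_move_right_mk₂] using ih (v ++ [a])

theorem iterate_step_back (b : Bool) (L R : List Bool) :
    ((M.control P).step O)^[L.length + 1]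
        (P.prepareCfg (.inl (.back b)) ((Tape.mk₂ (L.map some) (R.map some)).move .left) u) =
      P.prepareCfg (.inr (M.start, P.start (some b)))
        (Tape.mk₁ ((L.reverse ++ R).map some)) u := by
  induction L generalizing R with
  | nil =>
    rw [List.length_nil, zero_add, Function.iterate_one,
      step_prepareCfg (q := .inr (M.start, P.start (some b))) (erase := false) (d := some .right)
        (b := none) (fun read hread => by
          simp [prepare, hread, Option.default_eq_none, tape_move_left_mk₂, tape_head_mk₂])]
    simp [Tape.mk₁]
  | cons a L ih =>
    rw [List.length_cons, Function.iterate_succ_apply,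
      step_prepareCfg (q := .inl (.back b)) (erase := false) (d := some .left)
        (b := none) (fun read hread => by simp [prepare, hread, tape_move_left_mk₂, tape_head_mk₂])]
    simpa [tape_move_left_mk₂] using ih (a :: R)

theorem iterate_step_turn (u : List Bool) (a : Bool) :
    ((M.control P).step O)^[u.length + 3]
        (P.prepareCfg (.inl (.scan (some a))) (Tape.mk₂ ((u ++ [a]).map some).reverse []) u) =
      P.cfg (P.initial M (u ++ [a])) := by
  rw [show u.length + 3 = u.length + 1 + 1 + 1 from rfl, Function.iterate_succ_apply,
    step_prepareCfg (q := .inl (.turn a)) (erase := false) (d := some .left) (b := none)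
      (fun read hread => by simp [prepare, hread, Option.default_eq_none, tape_head_mk₂]),
    Function.iterate_succ_apply,
    step_prepareCfg (q := .inl (.back a)) (erase := P.strip) (d := some .left)
      (b := if P.strip then none else some a) (fun _ _ => rfl), ← prepareCfg_eq_cfg_initial]
  have hwrite (L : List (Option Bool)) (b : Option Bool) :
      (Tape.mk₂ L [b]).write none = Tape.mk₂ L [] :=
    tape_write_default_mk₂_singleton L b
  cases hstrip : P.strip
  · simpa [tape_move_left_mk₂, input, hstrip] using
      iterate_step_back (P := P) (O := O) (M := M) (u := u ++ [a]) a u.reverse [a]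
  · simpa [tape_move_left_mk₂, input, hstrip, hwrite] using
      iterate_step_back (P := P) (O := O) (M := M) (u := u) a u.reverse []

theorem exists_iterate_step_init (w : List Bool) : ∃ n ≤ 2 * w.length + 2,
    ((M.control P).step O)^[n] ((M.control P).init w) = P.cfg (P.initial M w) := by
  have hinit : (M.control P).init w =
      P.prepareCfg (.inl (.scan [].getLast?)) (Tape.mk₂ [] (w.map some)) [] := by
    simp only [prepareCfg, ite_self]
    rfl
  have hscan := iterate_step_scan (P := P) (O := O) (M := M) [] w
  rcases w.eq_nil_or_concat' with rfl | ⟨u, a, rfl⟩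
  · refine ⟨1, by simp, ?_⟩
    rw [hinit, Function.iterate_one, ← prepareCfg_eq_cfg_initial,
      step_prepareCfg (q := .inr (M.start, P.start none)) (erase := false) (d := none) (b := none)
        (fun read hread => by simp [prepare, hread, Option.default_eq_none, tape_head_mk₂])]
    simp [input, Tape.mk₁]
  · refine ⟨u.length + 3 + (u ++ [a]).length, by simp; omega, ?_⟩
    simp only [List.nil_append, List.getLast?_concat, List.dropLast_concat] at hscan
    rw [Function.iterate_add_apply, hinit]
    exact (congrArg _ hscan).trans (iterate_step_turn u a)

end Preparation

section Computation

variable {K ι ι' : Type} [DecidableEq ι] [DecidableEq ι'] [Finite K] {P : Controller K ι ι'}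
  {M : OracleTM ι}

theorem exists_polynomial_haltsWith (P : Controller K ι ι') (hM : M.PolyTime) (n : ℕ) :
    ∃ p : Polynomial ℕ, ∀ O Q w, P.Ensures O Q n (P.initial M w) →
      (M.control P).HaltsWith O (p.eval w.length) Q ((M.control P).init w) := by
  obtain ⟨p, hp⟩ := hM
  refine ⟨p + 2 * .X + .C (n + 2), fun O Q w h => ?_⟩
  obtain ⟨m, hm, hinit⟩ := exists_iterate_step_init (P := P) (M := M) (O := O) w
  have hlive : M.Live (p.eval (P.input w).length) (P.initial M w).sim := by
    refine ⟨fun _ => false, fun E _ => ?_⟩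
    obtain ⟨t, ht, b, hb⟩ := hp (constOracle E) (P.input w)
    exact ⟨t, ht, b, hb, trivial⟩
  have hhalt := haltsWith_of_ensures hlive h
  rw [← hinit] at hhalt
  refine hhalt.of_iterate.mono ?_
  have := polynomial_eval_mono p (P.length_input_le w)
  simp only [Polynomial.eval_add, Polynomial.eval_mul, Polynomial.eval_ofNat, Polynomial.eval_X,
    Polynomial.eval_C]
  omega

theorem polyTime_control (hM : M.PolyTime) {n : ℕ}
    (h : ∀ O w, P.Ensures O (fun _ _ _ => True) n (P.initial M w)) : (M.control P).PolyTime := by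
  obtain ⟨p, hp⟩ := P.exists_polynomial_haltsWith hM n
  refine ⟨p, fun O w => ?_⟩
  obtain ⟨t, ht, b, hb, -⟩ := hp O _ w (h O w)
  exact ⟨t, ht, b, hb⟩

end Computation

end Controller

namespace OracleTM

section Accepting

variable {ι : Type} [DecidableEq ι] (M : OracleTM ι) (O : ι → Language Bool)

/-- The computation of `M` from the configuration `c` is accepting. -/
def Accepts (c : M.Cfg) : Prop :=
  ∃ t, M.verdict ((M.step O)^[t] c) = some true

variable {M O} {c : M.Cfg}

theorem HaltsWith.accepts_iff {T : ℕ} {Q : Bool → List Bool → List (Finset ι) → Prop} {v : Bool}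
    (h : M.HaltsWith O T Q c) (hQ : ∀ b o l, Q b o l → b = v) : M.Accepts O c ↔ v = true := by
  obtain ⟨t, -, b, hb, hQb⟩ := h
  obtain rfl := hQ _ _ _ hQb
  refine ⟨?_, fun hbt => ⟨t, hbt ▸ hb⟩⟩
  rintro ⟨s, hs⟩
  have hst := Function.Commute.iterate_iterate_self (M.step O) s t c
  rw [iterate_step_of_verdict hb, iterate_step_of_verdict hs] at hst
  simpa [hst, hs, eq_comm] using hb

theorem HaltsWith.log_prefix {T : ℕ} {Q : Bool → List Bool → List (Finset ι) → Prop}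
    (h : M.HaltsWith O T Q c) (t : ℕ) : ∃ b o l, Q b o l ∧ ((M.step O)^[t] c).log <+: l := by
  obtain ⟨s, -, b, hb, hQ⟩ := h
  refine ⟨b, _, _, hQ, ?_⟩
  have hlog := log_prefix_iterate_step O ((M.step O)^[t] c) s
  rwa [Function.Commute.iterate_iterate_self, iterate_step_of_verdict hb] at hlog

theorem accepts_iterate_iff (n : ℕ) : M.Accepts O ((M.step O)^[n] c) ↔ M.Accepts O c := by
  constructor
  · rintro ⟨t, ht⟩
    exact ⟨t + n, by rwa [Function.iterate_add_apply]⟩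
  · rintro ⟨t, ht⟩
    refine ⟨t, ?_⟩
    rwa [Function.Commute.iterate_iterate_self, iterate_step_of_verdict ht]

theorem accepts_pause_iff : M.Accepts O (M.pause c) ↔ M.Accepts O c := by
  rw [← iterate_step_pauseTime O, accepts_iterate_iff]

theorem accepts_reply_iff {S : Finset ι} (hS : M.asks c = some S) :
    M.Accepts O (M.reply c fun i => indicator (O i) (c.query i)) ↔ M.Accepts O c := by
  rw [← step_of_asks hS]
  exact accepts_iterate_iff 1

end Accepting

section Obedient

variable {ι : Type} [DecidableEq ι] (M : OracleTM ι) (O : ι → Language Bool)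
  (R : List (Finset ι) → Prop) (c : M.Cfg)

/-- From the configuration `c`, the computation of `M` obeys `R` and eventually halts. -/
def Obedient : Prop :=
  (∀ t, R ((M.step O)^[t] c).log) ∧ ∃ T, M.HaltsWith O T (fun _ _ _ => True) c

/-- The verdict of the machine if it halts, starting from `c`, without asking further questions
(`false` otherwise). -/
noncomputable def finalVerdict : Bool :=
  (M.verdict (M.pause c)).getD false

variable {M O R c}

theorem PolyTime.obedient (hM : M.PolyTime) (hR : M.Obeys O R) (x : List Bool) :
    M.Obedient O R (M.init x) := by
  obtain ⟨p, hp⟩ := hM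
  obtain ⟨t, ht, b, hb⟩ := hp O x
  exact ⟨hR x, _, t, ht, b, hb, trivial⟩

namespace Obedient

theorem iterate (h : M.Obedient O R c) (n : ℕ) : M.Obedient O R ((M.step O)^[n] c) := by
  obtain ⟨hR, T, hT⟩ := h
  refine ⟨fun t => ?_, _, hT.iterate⟩
  rw [← Function.iterate_add_apply]
  exact hR _

theorem pause (h : M.Obedient O R c) : M.Obedient O R (M.pause c) := by
  simpa only [iterate_step_pauseTime] using h.iterate (M.pauseTime c)

theorem reply (h : M.Obedient O R c) {S : Finset ι} (hS : M.asks c = some S) :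
    M.Obedient O R (M.reply c fun i => indicator (O i) (c.query i)) := by
  simpa only [Function.iterate_one, step_of_asks hS] using h.iterate 1

theorem log_asks (h : M.Obedient O R c) {S : Finset ι} (hS : M.asks (M.pause c) = some S) :
    R (c.log ++ [S]) := by
  simpa only [Function.iterate_zero_apply, reply_log hS, pause_log] using (h.pause.reply hS).1 0

theorem accepts_iff_of_asks_eq_none (h : M.Obedient O R c) (hc : M.asks (M.pause c) = none) :
    M.Accepts O c ↔ M.finalVerdict c = true := by
  obtain ⟨-, T, hT⟩ := h
  obtain ⟨b, hb⟩ : ∃ b, M.verdict (M.pause c) = some b :=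
    Option.ne_none_iff_exists'.1 fun hv => hT.not_isMove_pause ⟨hv, hc⟩
  have hhalt : M.HaltsWith O 0 (fun v _ _ => v = b) (M.pause c) := ⟨0, le_rfl, b, hb, rfl⟩
  rw [← accepts_pause_iff, hhalt.accepts_iff fun _ _ _ h => h, finalVerdict, hb, Option.getD_some]

end Obedient

end Obedient

end OracleTM

namespace Controller

open OracleTM

variable {K ι ι' : Type} [DecidableEq ι] [DecidableEq ι'] {P : Controller K ι ι'} {M : OracleTM ι}

theorem Ensures.imp {O : ι' → Language Bool} {Q Q' : Bool → List Bool → List (Finset ι') → Prop}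
    {n : ℕ} {s : Session M K ι'} (h : P.Ensures O Q n s) (hQ : ∀ b o l, Q b o l → Q' b o l) :
    P.Ensures O Q' n s := by
  induction n generalizing s with
  | zero => exact h
  | succ n ih =>
    rw [Ensures] at h ⊢
    cases hcmd : P.command (P.pause s) with rw [hcmd] at h
    | feed a next => exact ⟨h.1, ih h.2⟩
    | query S next => exact ih h
    | output b => exact hQ _ _ _ h
    | halt b => exact hQ _ _ _ h

theorem control_spec [Finite K] (hM : M.PolyTime) {R : List (Finset ι') → Prop}
    (hR : ∀ ⦃l l'⦄, l <+: l' → R l' → R l) {v : (ι' → Language Bool) → List Bool → Bool} {n : ℕ}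
    (h : ∀ O w, P.Ensures O (fun b _ l => b = v O w ∧ R l) n (P.initial M w)) :
    (M.control P).PolyTime ∧ ∀ O, (M.control P).Obeys O R ∧
      {w : List Bool | v O w = true} = (M.control P).accepted O := by
  obtain ⟨p, hp⟩ := P.exists_polynomial_haltsWith hM n
  refine ⟨polyTime_control hM fun O w => (h O w).imp fun _ _ _ _ => trivial, fun O => ⟨?_, ?_⟩⟩
  · intro w t
    obtain ⟨-, -, l, ⟨-, hl⟩, hlog⟩ := (hp _ _ _ (h O w)).log_prefix t
    exact hR hlog hl
  · exact Set.ext fun w => ((hp _ _ _ (h O w)).accepts_iff fun _ _ _ h => h.1).symm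

theorem mem_FPOneQuery [Finite K] {P : Controller K ι (Fin 1)} (hM : M.PolyTime)
    {f : (Fin 1 → Language Bool) → List Bool → List Bool} {n : ℕ}
    (h : ∀ O w, P.Ensures O (fun _ o l => o = f O w ∧ l.length ≤ 1) n (P.initial M w))
    {𝒟 : ComplexityClass} {D : Language Bool} (hD : D ∈ 𝒟) : f ![D] ∈ FPOneQuery 𝒟 := by
  obtain ⟨p, hp⟩ := P.exists_polynomial_haltsWith hM n
  refine ⟨D, hD, M.control P, polyTime_control hM fun O w => (h O w).imp fun _ _ _ _ => trivial,
    fun w t => ?_, fun w => ?_⟩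
  · obtain ⟨-, -, l, ⟨-, hl⟩, hlog⟩ := (hp _ _ _ (h ![D] w)).log_prefix t
    exact hlog.length_le.trans hl
  · obtain ⟨t, -, b, hb, hout, -⟩ := hp _ _ _ (h ![D] w)
    exact ⟨t, b, hb, hout⟩

end Controller

namespace OracleTM

variable {ι : Type} [DecidableEq ι] (M : OracleTM ι)

/-- The verdict of `M` from the configuration `c` if its next question, in case it is one to the
oracle `j` alone, is answered by `a`, and `M` then asks nothing else. -/
noncomputable def verdictOn (j : ι) (a : Bool) (c : M.Cfg) : Bool :=
  if M.asks (M.pause c) = some {j} then M.finalVerdict (M.reply (M.pause c) fun _ => a)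
  else M.finalVerdict c

/-- The verdict of `M` from the configuration `c` if the oracle `j` is the language `D`, and `M`
asks at most one question, to `j` alone. -/
noncomputable def verdictVia (j : ι) (D : Language Bool) (c : M.Cfg) : Bool :=
  M.verdictOn j (indicator D ((M.pause c).query j)) c

variable {M}

theorem finalVerdict_eq_false {c : M.Cfg} {S : Finset ι} (h : M.asks (M.pause c) = some S) :
    M.finalVerdict c = false := by
  rw [finalVerdict, verdict_eq_none_of_asks h, Option.getD_none]

theorem finalVerdict_pause (c : M.Cfg) : M.finalVerdict (M.pause c) = M.finalVerdict c := by
  rw [finalVerdict, pause_pause, finalVerdict]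

theorem verdictOn_pause (j : ι) (a : Bool) (c : M.Cfg) :
    M.verdictOn j a (M.pause c) = M.verdictOn j a c := by
  simp only [verdictOn, finalVerdict_pause, pause_pause]

theorem forall_mem_reply_pause_log {c : M.Cfg} {S : Finset ι} (h : M.asks (M.pause c) = some S)
    (a : ι → Bool) {p : Finset ι → Prop} :
    (∀ T ∈ (M.reply (M.pause c) a).log, p T) ↔ (∀ T ∈ c.log, p T) ∧ p S := by
  simp [reply_log h, pause_log, or_imp, forall_and]

end OracleTM

namespace Controller

open OracleTM

section Tapes

variable {K ι ι' : Type} [DecidableEq ι] {P : Controller K ι ι'} {M : OracleTM ι}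
  {s : Session M K ι'} {i : ι}

theorem pause_sim : (P.pause s).sim = M.pause s.sim :=
  rfl

theorem pause_phase : (P.pause s).phase = s.phase :=
  rfl

theorem pause_query_of_source {o : ι'} (ho : P.source o = some i) (h : s.query o = s.sim.query i) :
    (P.pause s).query o = (M.pause s.sim).query i := by
  simpa [pause, moved, ho, h, OracleTM.pause] using query_append_emitted le_rfl i

theorem feed_query_of_source {o : ι'} (ho : P.source o = some i) (h : s.query o = s.sim.query i)
    {S : Finset ι} (hS : M.asks (M.pause s.sim) = some S) (hi : i ∉ S) (a : ι → Bool) (k : K) :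
    ((P.pause s).feed a k).query o = (M.reply (M.pause s.sim) a).query i := by
  rw [reply_query hS, if_neg hi]
  exact pause_query_of_source ho h

theorem pause_query_of_source_eq_none {o : ι'} (ho : P.source o = none) :
    (P.pause s).query o = s.query o := by
  simp [pause, moved, ho]

theorem pause_out_of_outSource_eq_none (ho : P.outSource s.phase = none) :
    (P.pause s).out = s.out := by
  simp [pause, moved, ho]

theorem pause_out_of_outSource {b : Bool} (ho : P.outSource s.phase = if b then some i else none)
    (h : s.out = if b then s.sim.query i else []) :
    (P.pause s).out = if b then (M.pause s.sim).query i else [] := by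
  cases b with
  | false => rwa [pause_out_of_outSource_eq_none ho]
  | true => simpa [pause, moved, ho, h, OracleTM.pause] using query_append_emitted le_rfl i

end Tapes

section Rules

variable {K ι ι' : Type} [DecidableEq ι] [DecidableEq ι'] {P : Controller K ι ι'} {M : OracleTM ι}
  {O : ι' → Language Bool} {Q : Bool → List Bool → List (Finset ι') → Prop} {n : ℕ}
  {s : Session M K ι'}

theorem ensures_succ_of_asks {S : Finset ι} (hS : M.asks (M.pause s.sim) = some S) :
    P.Ensures O Q (n + 1) s ↔
      (P.onAsk s.phase S).Ensures (P.Ensures O Q n) O Q (P.pause s) := by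
  have hcmd : P.command (P.pause s) = P.onAsk s.phase S := by
    simp [command, pause_sim, pause_phase, hS]
  rw [Ensures, hcmd]

theorem ensures_succ_of_asks_eq_none (h : M.asks (M.pause s.sim) = none) :
    P.Ensures O Q (n + 1) s ↔
      (P.onHalt s.phase (M.finalVerdict s.sim)).Ensures (P.Ensures O Q n) O Q (P.pause s) := by
  have hcmd : P.command (P.pause s) = P.onHalt s.phase (M.finalVerdict s.sim) := by
    simp [command, pause_sim, pause_phase, h, finalVerdict]
  rw [Ensures, hcmd]

theorem ensures_feed {S : Finset ι} {a : ι → Bool} {next : K}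
    (hS : M.asks (M.pause s.sim) = some S) (hcmd : P.onAsk s.phase S = .feed a next)
    (hfresh : ∀ S' ∈ s.sim.log, Disjoint S' S) (h : P.Ensures O Q n ((P.pause s).feed a next)) :
    P.Ensures O Q (n + 1) s := by
  rw [ensures_succ_of_asks hS, hcmd]
  rw [← OracleTM.pause_log s.sim] at hfresh
  exact ⟨⟨S, hS, hfresh⟩, h⟩

theorem ensures_of_finalVerdict {fin : Bool → Command K ι ι'}
    (hask : ∀ S, M.asks (M.pause s.sim) = some S → P.onAsk s.phase S = fin false)
    (hhalt : ∀ v, P.onHalt s.phase v = fin v)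
    (h : (fin (M.finalVerdict s.sim)).Ensures (P.Ensures O Q n) O Q (P.pause s)) :
    P.Ensures O Q (n + 1) s := by
  cases hS : M.asks (M.pause s.sim) with
  | none => rwa [ensures_succ_of_asks_eq_none hS, hhalt]
  | some S => rwa [ensures_succ_of_asks hS, hask S hS, ← finalVerdict_eq_false hS]

theorem ensures_of_command {cmd : Command K ι ι'}
    (hask : ∀ S, M.asks (M.pause s.sim) = some S → P.onAsk s.phase S = cmd)
    (hhalt : ∀ v, P.onHalt s.phase v = cmd)
    (h : cmd.Ensures (P.Ensures O Q n) O Q (P.pause s)) : P.Ensures O Q (n + 1) s :=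
  ensures_of_finalVerdict (fin := fun _ => cmd) hask hhalt h

theorem ensures_of_verdictOn {j : ι} {a : Bool} {k : K} {fin : Bool → Command K ι ι'}
    (hask : ∀ S, P.onAsk s.phase S = if S = {j} then .feed (fun _ => a) k else fin false)
    (hhalt : ∀ v, P.onHalt s.phase v = fin v) (hask_k : ∀ S, P.onAsk k S = fin false)
    (hhalt_k : ∀ v, P.onHalt k v = fin v) (hfresh : ∀ S ∈ s.sim.log, Disjoint S {j})
    (hout : ∀ k, P.outSource k = none)
    (h : ∀ n (s' : Session M K ι'), s'.out = s.out → s'.log = s.log →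
      (fin (M.verdictOn j a s.sim)).Ensures (P.Ensures O Q n) O Q s') :
    P.Ensures O Q (n + 2) s := by
  by_cases hj : M.asks (M.pause s.sim) = some {j}
  · rw [verdictOn, if_pos hj] at h
    have hs' : (P.pause ((P.pause s).feed (fun _ => a) k)).out = s.out := by
      rw [pause_out_of_outSource_eq_none (hout _)]
      exact pause_out_of_outSource_eq_none (hout _)
    exact ensures_feed hj (by rw [hask, if_pos rfl]) hfresh
      (ensures_of_finalVerdict (fun S _ => hask_k S) hhalt_k (h _ _ hs' rfl))
  · rw [verdictOn, if_neg hj] at h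
    refine ensures_of_finalVerdict (fun S hS => ?_) hhalt
      (h _ _ (pause_out_of_outSource_eq_none (hout _)) rfl)
    rw [hask, if_neg (by rintro rfl; exact hj hS)]

theorem ensures_of_verdictVia {j : ι} {o : ι'} {T : Finset ι'} {next k : (ι' → Bool) → K}
    {fin : (ι' → Bool) → Bool → Command K ι ι'} (ho : o ∈ T) (hsource : P.source o = some j)
    (hquery : s.query o = s.sim.query j) (hask : ∀ S, P.onAsk s.phase S = .query T next)
    (hhalt : ∀ v, P.onHalt s.phase v = .query T next)
    (hask_next : ∀ a S, P.onAsk (next a) S =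
      if S = {j} then .feed (fun _ => a o) (k a) else fin a false)
    (hhalt_next : ∀ a v, P.onHalt (next a) v = fin a v)
    (hask_k : ∀ a S, P.onAsk (k a) S = fin a false)
    (hhalt_k : ∀ a v, P.onHalt (k a) v = fin a v) (hfresh : ∀ S ∈ s.sim.log, Disjoint S {j})
    (hout : ∀ k, P.outSource k = none)
    (h : ∀ n (s' : Session M K ι'), s'.out = s.out → s'.log = s.log ++ [T] →
      (fin (answers O T (P.pause s).query) (M.verdictVia j (O o) s.sim)).Ensures
        (P.Ensures O Q n) O Q s') :
    P.Ensures O Q (n + 3) s := by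
  have hanswer : answers O T (P.pause s).query o = indicator (O o) ((M.pause s.sim).query j) := by
    rw [answers_of_mem ho, pause_query_of_source hsource hquery]
  rw [verdictVia, ← hanswer] at h
  refine ensures_of_command (fun S _ => hask S) hhalt (ensures_of_verdictOn (hask_next _)
    (hhalt_next _) (hask_k _) (hhalt_k _) ?_ hout fun n s' hs' => ?_)
  · change ∀ S ∈ (M.pause s.sim).log, Disjoint S {j}
    rwa [OracleTM.pause_log]
  · change _ → (fin _ (M.verdictOn j _ (M.pause s.sim))).Ensures _ O Q s'
    rw [verdictOn_pause]
    exact h n s' (hs'.trans (pause_out_of_outSource_eq_none (hout _)))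

end Rules

end Controller

namespace OracleTM

variable {ι : Type} [DecidableEq ι] (M : OracleTM ι)

/-- The letter that `Controller.probe` appends to the word `x`, after reading the letter `b`. -/
noncomputable def probeBit (e b : Bool) (i j : ι) (D : Language Bool) (x : List Bool) : Bool :=
  if M.asks (M.pause (M.init x)) = some {i} then
    M.verdictVia j D (M.reply (M.pause (M.init x)) fun _ => e) ^^ b
  else true

end OracleTM

/-- The phases of `Controller.probe`: `b` is the letter read from the input, `a` is the answer of
the oracle. -/
inductive ProbePhase where
  | start (b : Bool)
  | assumed (b : Bool)
  | asked (b a : Bool)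
  | finished (b : Bool)
  deriving Fintype

namespace Controller

open OracleTM

section Probe

variable {ι : Type} [DecidableEq ι]

/-- The controller that appends a letter to the input `x`: the verdict on `x` of a machine that
first asks the oracle `i`, if this question is answered by `e` and if a second question, to `j`, is
answered by the own oracle. For `e = true` the input comes with the letter for `e = false`, which is
replaced by the exclusive or of both letters, that is, by the information whether the answer of `i`
matters. For a machine that does not ask `i` first, it always does. -/
def probe (e : Bool) (i j : ι) : Controller ProbePhase ι (Fin 1) where
  strip := e
  copyQuery _ := false
  copyOut := true
  start b := .start (e && b.getD false)
  source _ := some j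
  outSource _ := none
  onAsk
    | .start b, S => if S = {i} then .feed (fun _ => e) (.assumed b) else .output true
    | .assumed b, _ => .query {0} fun a => .asked b (a 0)
    | .asked b a, S => if S = {j} then .feed (fun _ => a) (.finished b) else .output (false ^^ b)
    | .finished b, _ => .output (false ^^ b)
  onHalt
    | .start _, _ => .output true
    | .assumed b, _ => .query {0} fun a => .asked b (a 0)
    | .asked b _, v => .output (v ^^ b)
    | .finished b, v => .output (v ^^ b)

variable {M : OracleTM ι} {i j : ι}

theorem ensures_probe (hij : i ≠ j) (e : Bool) (O : Fin 1 → Language Bool) (w : List Bool) :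
    (probe e i j).Ensures O
      (fun _ o l => o = (probe e i j).input w ++
          [M.probeBit e (e && w.getLast?.getD false) i j (O 0) ((probe e i j).input w)] ∧
        l.length ≤ 1) 4 ((probe e i j).initial M w) := by
  set b := e && w.getLast?.getD false
  by_cases hi : M.asks (M.pause (M.init ((probe e i j).input w))) = some {i}
  · rw [probeBit, if_pos hi]
    refine ensures_feed hi (if_pos rfl) (List.forall_mem_nil _) ?_
    refine ensures_of_verdictVia (next := fun a => .asked b (a 0)) (k := fun _ => .finished b)
      (fin := fun _ v => .output (v ^^ b)) (Finset.mem_singleton_self 0) rfl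
      (feed_query_of_source rfl rfl hi (by simpa using hij.symm) _ _) (fun _ => rfl) (fun _ => rfl)
      (fun _ _ => rfl) (fun _ _ => rfl) (fun _ _ => rfl) (fun _ _ => rfl)
      ((forall_mem_reply_pause_log hi _).2 ⟨List.forall_mem_nil _, by simpa using hij⟩)
      (fun _ => rfl) fun _ s' hout hlog => ⟨?_, by rw [hlog]; exact le_rfl⟩
    rw [hout]
    exact congrArg (· ++ _) (pause_out_of_outSource_eq_none rfl)
  · rw [probeBit, if_neg hi]
    refine ensures_of_command (cmd := .output true) (fun S hS => if_neg ?_) (fun _ => rfl)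
      ⟨?_, Nat.zero_le _⟩
    · rintro rfl
      exact hi hS
    · rw [pause_out_of_outSource_eq_none rfl]
      rfl

end Probe

end Controller

namespace OracleTM

variable {ι : Type} [DecidableEq ι] (M : OracleTM ι)

/-- What `M` has written on the query tape of `i` when it asks or halts for the next time after the
configuration `c` or, if its next question is one to the oracle `j` alone, when it asks or halts
after receiving the answer `a`. -/
noncomputable def queryOn (i j : ι) (a : Bool) (c : M.Cfg) : List Bool :=
  if M.asks (M.pause c) = some {j} then (M.pause (M.reply (M.pause c) fun _ => a)).query i
  else (M.pause c).query i

/-- The word about which `M` asks the oracle `i` on the input `x` (if it does so at all), provided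
that the oracle `j` is the language `D` and `M` asks at most one question to each of `i` and `j`. -/
noncomputable def relevantQuery (i j : ι) (D : Language Bool) (x : List Bool) : List Bool :=
  M.queryOn i j (indicator D ((M.pause (M.init x)).query j)) (M.init x)

variable {M}

theorem queryOn_pause (i j : ι) (a : Bool) (c : M.Cfg) :
    M.queryOn i j a (M.pause c) = M.queryOn i j a c := by
  simp only [queryOn, pause_pause]

end OracleTM

/-- The phases of `Controller.extract`: `b` is the letter read from the input, `a` is the answer of
the oracle. -/
inductive ExtractPhase where
  | start (b : Bool)
  | asked (b a : Bool)
  | finished (b : Bool)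
  deriving Fintype

namespace Controller

open OracleTM

section Extract

variable {ι : Type} [DecidableEq ι]

/-- The controller that reads a letter at the end of the input and, if this letter is `true`,
outputs the relevant query to the oracle `i` of a machine whose oracle `j` is the own oracle. -/
def extract (i j : ι) : Controller ExtractPhase ι (Fin 1) where
  strip := true
  copyQuery _ := false
  copyOut := false
  start b := .start (b.getD false)
  source _ := some j
  outSource
    | .start b | .asked b _ | .finished b => if b then some i else none
  onAsk
    | .start b, _ => .query {0} fun a => .asked b (a 0)
    | .asked b a, S => if S = {j} then .feed (fun _ => a) (.finished b) else .halt true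
    | .finished _, _ => .halt true
  onHalt
    | .start b, _ => .query {0} fun a => .asked b (a 0)
    | .asked _ _, _ | .finished _, _ => .halt true

variable {M : OracleTM ι} {i j : ι}

theorem ensures_extract_asked {O : Fin 1 → Language Bool} {s : Session M ExtractPhase (Fin 1)}
    {b a : Bool} (hij : i ≠ j) (hphase : s.phase = .asked b a)
    (hout : s.out = if b then s.sim.query i else []) (hfresh : ∀ S ∈ s.sim.log, Disjoint S {j}) :
    (extract i j).Ensures O
      (fun _ o l => o = (if b then M.queryOn i j a s.sim else []) ∧ l = s.log) 2 s := by
  have hpause := pause_out_of_outSource (P := extract i j) (by rw [hphase]; rfl) hout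
  by_cases hj : M.asks (M.pause s.sim) = some {j}
  · rw [queryOn, if_pos hj]
    refine ensures_feed hj (by rw [hphase]; exact if_pos rfl) hfresh ?_
    have hreply : (M.reply (M.pause s.sim) fun _ => a).query i = (M.pause s.sim).query i := by
      rw [reply_query hj, if_neg (by simpa using hij)]
    rw [← hreply] at hpause
    exact ensures_of_command (cmd := .halt true) (fun _ _ => rfl) (fun _ => rfl)
      ⟨pause_out_of_outSource rfl hpause, rfl⟩
  · rw [queryOn, if_neg hj]
    refine ensures_of_command (cmd := .halt true) (fun S hS => ?_)
      (fun _ => by rw [hphase]; rfl) ⟨hpause, rfl⟩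
    rw [hphase]
    exact if_neg (by rintro rfl; exact hj hS)

theorem ensures_extract (hij : i ≠ j) (O : Fin 1 → Language Bool) (w : List Bool) :
    (extract i j).Ensures O
      (fun _ o l => o =
          (if w.getLast?.getD false then M.relevantQuery i j (O 0) w.dropLast else []) ∧
        l.length ≤ 1) 3 ((extract i j).initial M w) := by
  set s := (extract i j).initial M w
  have hanswer : answers O {0} ((extract i j).pause s).query 0 =
      indicator (O 0) ((M.pause (M.init w.dropLast)).query j) := by
    rw [answers_of_mem (Finset.mem_singleton_self _), pause_query_of_source (i := j) rfl rfl]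
    rfl
  have hpause : ((extract i j).pause s).out =
      if w.getLast?.getD false then (M.pause (M.init w.dropLast)).query i else [] :=
    pause_out_of_outSource rfl (by split_ifs <;> rfl)
  rw [relevantQuery, ← queryOn_pause, ← hanswer]
  refine ensures_of_command (fun _ _ => rfl) (fun _ => rfl) (Ensures.imp
    (ensures_extract_asked hij rfl hpause ?_) fun _ _ _ ⟨ho, hl⟩ => ⟨ho, hl ▸ le_rfl⟩)
  change ∀ S ∈ (M.pause (M.init w.dropLast)).log, Disjoint S {j}
  rw [OracleTM.pause_log]
  exact List.forall_mem_nil _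

end Extract

end Controller

namespace OracleTM

variable {ι : Type} [DecidableEq ι] (M : OracleTM ι)

/-- The verdict of `M` on the input `x`, as computed from two answers only: the answer `d` to a
first question to `i` is not the true one, but a guess, which is right if and only if `g = d`
whenever it matters. If `j`, with the oracle `D`, is asked first, then `g` is the answer of `i`. -/
noncomputable def combinedVerdict (d g : Bool) (i j : ι) (D : Language Bool) (x : List Bool) :
    Bool :=
  if M.asks (M.pause (M.init x)) = some {i} then
    M.verdictVia j D (M.reply (M.pause (M.init x)) fun _ => d) ^^ (g ^^ d)
  else if M.asks (M.pause (M.init x)) = some {j} then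
    M.verdictOn i g (M.reply (M.pause (M.init x)) fun _ =>
      indicator D ((M.pause (M.init x)).query j))
  else M.finalVerdict (M.init x)

end OracleTM

/-- The phases of `Controller.combine`: `g` and `a` are the answers of the oracles `0` and `1`, and
`f` tells whether the verdict has to be negated. -/
inductive CombinePhase where
  | start
  | assumed
  | assumedAsked (f a : Bool)
  | asked (g a : Bool)
  | answered (g : Bool)
  | finished (f : Bool)
  deriving Fintype

namespace Controller

open OracleTM

section Combine

variable {ι : Type} [DecidableEq ι]

/-- The controller that computes `OracleTM.combinedVerdict` with two simultaneous queries: the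
oracle `0` is asked about the input, and the oracle `1` plays the role of `j`. -/
def combine (d : Bool) (i j : ι) : Controller CombinePhase ι (Fin 2) where
  strip := false
  copyQuery o := o = 0
  copyOut := false
  start _ := .start
  source o := if o = 0 then none else some j
  outSource _ := none
  onAsk
    | .start, S =>
      if S = {i} then .feed (fun _ => d) .assumed else .query .univ fun a => .asked (a 0) (a 1)
    | .assumed, _ => .query .univ fun a => .assumedAsked (a 0 ^^ d) (a 1)
    | .assumedAsked f a, S =>
      if S = {j} then .feed (fun _ => a) (.finished f) else .halt (false ^^ f)
    | .asked g a, S => if S = {j} then .feed (fun _ => a) (.answered g) else .halt false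
    | .answered g, S =>
      if S = {i} then .feed (fun _ => g) (.finished false) else .halt (false ^^ false)
    | .finished f, _ => .halt (false ^^ f)
  onHalt
    | .start, _ => .query .univ fun a => .asked (a 0) (a 1)
    | .assumed, _ => .query .univ fun a => .assumedAsked (a 0 ^^ d) (a 1)
    | .assumedAsked f _, v | .finished f, v => .halt (v ^^ f)
    | .asked _ _, v => .halt v
    | .answered _, v => .halt (v ^^ false)

variable {M : OracleTM ι} {i j : ι}

theorem ensures_combine_asked {O : Fin 2 → Language Bool} {d g a : Bool}
    {s : Session M CombinePhase (Fin 2)} (hij : i ≠ j) (hphase : s.phase = .asked g a)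
    (hlog : s.sim.log = []) :
    (combine d i j).Ensures O
      (fun b _ l => b = (if M.asks (M.pause s.sim) = some {j} then
          M.verdictOn i g (M.reply (M.pause s.sim) fun _ => a) else M.finalVerdict s.sim) ∧
        l = s.log) 3 s := by
  by_cases hj : M.asks (M.pause s.sim) = some {j}
  · rw [if_pos hj]
    refine ensures_feed hj (by rw [hphase]; exact if_pos rfl) (by simp [hlog]) ?_
    refine ensures_of_verdictOn (k := .finished false) (fin := fun v => .halt (v ^^ false))
      (fun _ => rfl) (fun _ => rfl) (fun _ => rfl) (fun _ => rfl)
      ((forall_mem_reply_pause_log hj _).2 ⟨by simp [hlog], by simpa using hij.symm⟩)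
      (fun _ => rfl) fun _ s' _ hs' => ⟨Bool.xor_false _, hs'⟩
  · rw [if_neg hj]
    refine ensures_of_finalVerdict (fin := .halt) (fun S hS => ?_)
      (fun _ => by rw [hphase]; rfl) ⟨rfl, rfl⟩
    rw [hphase]
    exact if_neg (by rintro rfl; exact hj hS)

theorem ensures_combine (hij : i ≠ j) (d : Bool) (O : Fin 2 → Language Bool) (x : List Bool) :
    (combine d i j).Ensures O
      (fun b _ l => b = M.combinedVerdict d (indicator (O 0) x) i j (O 1) x ∧ l.length ≤ 1) 4
      ((combine d i j).initial M x) := by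
  set s := (combine d i j).initial M x
  by_cases hi : M.asks (M.pause (M.init x)) = some {i}
  · rw [combinedVerdict, if_pos hi]
    refine ensures_feed hi (if_pos rfl) (List.forall_mem_nil _) ?_
    refine ensures_of_verdictVia (next := fun a => .assumedAsked (a 0 ^^ d) (a 1))
      (k := fun a => .finished (a 0 ^^ d)) (fin := fun a v => .halt (v ^^ (a 0 ^^ d)))
      (Finset.mem_univ 1) rfl
      (feed_query_of_source rfl rfl hi (by simpa using hij.symm) _ _) (fun _ => rfl) (fun _ => rfl)
      (fun _ _ => rfl) (fun _ _ => rfl) (fun _ _ => rfl) (fun _ _ => rfl)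
      ((forall_mem_reply_pause_log hi _).2 ⟨List.forall_mem_nil _, by simpa using hij⟩)
      (fun _ => rfl) fun _ s' _ hlog => ⟨?_, by rw [hlog]; exact le_rfl⟩
    rw [answers_of_mem (Finset.mem_univ 0), pause_query_of_source_eq_none rfl]
    exact congrArg (fun q => _ ^^ (indicator (O 0) q ^^ d)) (pause_query_of_source_eq_none rfl)
  · rw [combinedVerdict, if_neg hi]
    have hinput : answers O .univ ((combine d i j).pause s).query 0 = indicator (O 0) x := by
      rw [answers_of_mem (Finset.mem_univ 0), pause_query_of_source_eq_none rfl]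
      rfl
    have hanswer : answers O .univ ((combine d i j).pause s).query 1 =
        indicator (O 1) ((M.pause (M.init x)).query j) := by
      rw [answers_of_mem (Finset.mem_univ 1), pause_query_of_source (i := j) rfl rfl]
      rfl
    refine ensures_of_command (fun S hS => if_neg ?_) (fun _ => rfl) (Ensures.imp
      (ensures_combine_asked hij rfl (OracleTM.pause_log _))
      fun b _ _ ⟨hb, hl⟩ => ⟨?_, hl ▸ le_rfl⟩)
    · rintro rfl
      exact hi hS
    · rw [← hinput, ← hanswer]
      have hpause : M.pause ((combine d i j).pause s).sim = M.pause (M.init x) := pause_pause _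
      have hfinal : M.finalVerdict ((combine d i j).pause s).sim = M.finalVerdict (M.init x) :=
        finalVerdict_pause _
      rw [← hpause, ← hfinal]
      exact hb

end Combine

end Controller

namespace OracleTM

variable {ι : Type} [DecidableEq ι] {M : OracleTM ι}

theorem reply_of_asks_eq_none {c : M.Cfg} (h : M.asks c = none) (a : ι → Bool) :
    M.reply c a = c := by
  unfold asks at h
  unfold reply
  cases hc : M.action c with
  | ask S next => simp [hc] at h
  | halt b => rfl
  | move next write dir emit out => rfl

end OracleTM

/-- The phases of `Controller.sequential`: `a` and `b` are the answers of the oracles `0` and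
`1`. -/
inductive SequentialPhase where
  | start
  | askedFirst (a : Bool)
  | askedBoth (a b : Bool)
  | finished
  deriving Fintype

namespace Controller

open OracleTM

section Sequential

variable {ι : Type} [DecidableEq ι]

/-- The controller that makes two queries before the first question of its machine is answered: one
to the oracle `0` in the role of `i`, and then one to the oracle `1` in the role of all others, for
which it passes on the query to `j`. -/
def sequential (i j : ι) : Controller SequentialPhase ι (Fin 2) where
  strip := false
  copyQuery _ := false
  copyOut := false
  start _ := .start
  source o := if o = 0 then some i else some j
  outSource _ := none
  onAsk
    | .start, _ => .query {0} fun a => .askedFirst (a 0)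
    | .askedFirst a, _ => .query {1} fun b => .askedBoth a (b 1)
    | .askedBoth a b, _ => .feed (fun o => if o = i then a else b) .finished
    | .finished, _ => .halt false
  onHalt
    | .start, _ => .query {0} fun a => .askedFirst (a 0)
    | .askedFirst a, _ => .query {1} fun b => .askedBoth a (b 1)
    | .askedBoth _ _, v | .finished, v => .halt v

variable {M : OracleTM ι} {i j : ι}

theorem ensures_sequential_askedBoth {O : Fin 2 → Language Bool}
    {s : Session M SequentialPhase (Fin 2)} {a b : Bool} (hphase : s.phase = .askedBoth a b)
    (hlog : s.sim.log = []) :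
    (sequential i j).Ensures O
      (fun v _ l => v = M.finalVerdict (M.reply (M.pause s.sim) fun o => if o = i then a else b) ∧
        l = s.log) 2 s := by
  cases hS : M.asks (M.pause s.sim) with
  | none =>
    rw [ensures_succ_of_asks_eq_none hS, reply_of_asks_eq_none hS, finalVerdict_pause, hphase]
    exact ⟨rfl, rfl⟩
  | some S =>
    exact ensures_feed hS (by rw [hphase]; rfl) (by simp [hlog])
      (ensures_of_finalVerdict (fin := .halt) (fun _ _ => rfl) (fun _ => rfl) ⟨rfl, rfl⟩)

theorem ensures_sequential (O : Fin 2 → Language Bool) (x : List Bool) :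
    (sequential i j).Ensures O
      (fun v _ l => v = M.finalVerdict (M.reply (M.pause (M.init x)) fun o =>
          if o = i then indicator (O 0) ((M.pause (M.init x)).query i)
          else indicator (O 1) ((M.pause (M.init x)).query j)) ∧ l.Sublist [{0}, {1}]) 4
      ((sequential i j).initial M x) := by
  set s := (sequential i j).initial M x
  have hfirst : answers O {0} ((sequential i j).pause s).query 0 =
      indicator (O 0) ((M.pause (M.init x)).query i) := by
    rw [answers_of_mem (Finset.mem_singleton_self _), pause_query_of_source (i := i) rfl rfl]
    rfl
  set s₁ := ((sequential i j).pause s).ask O {0} fun a => SequentialPhase.askedFirst (a 0)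
  have hquery : s₁.query 1 = s₁.sim.query j := by
    change ((sequential i j).pause s).query 1 = ((sequential i j).pause s).sim.query j
    exact pause_query_of_source rfl rfl
  have hsecond : answers O {1} ((sequential i j).pause s₁).query 1 =
      indicator (O 1) ((M.pause (M.init x)).query j) := by
    rw [answers_of_mem (Finset.mem_singleton_self _), pause_query_of_source (i := j) rfl hquery]
    exact congrArg (fun c => indicator (O 1) (c.query j)) (pause_pause (M.init x))
  rw [← hfirst, ← hsecond]
  have hsim : M.pause ((sequential i j).pause s₁).sim = M.pause (M.init x) := by
    change M.pause (M.pause (M.pause (M.init x))) = M.pause (M.init x)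
    simp only [pause_pause]
  refine ensures_of_command (fun _ _ => rfl) (fun _ => rfl)
    (ensures_of_command (fun _ _ => rfl) (fun _ => rfl)
      ((ensures_sequential_askedBoth rfl ?_).imp fun v _ _ ⟨hv, hl⟩ => ⟨?_, ?_⟩))
  · change (M.pause (M.pause (M.init x))).log = []
    simp only [OracleTM.pause_log]
    rfl
  · rw [← hsim]
    exact hv
  · rw [hl]
    exact List.Sublist.refl _

end Sequential

end Controller

/-- Each of the oracles `i` and `j` is asked at most once, in arbitrary order, and not together
with another one. -/
def AtMostOnceEach {ι : Type} (i j : ι) (l : List (Finset ι)) : Prop :=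
  l.Sublist [{i}, {j}] ∨ l.Sublist [{j}, {i}]

namespace AtMostOnceEach

variable {ι : Type} {i j : ι} {S T : Finset ι}

theorem symm {l : List (Finset ι)} (h : AtMostOnceEach i j l) : AtMostOnceEach j i l :=
  Or.symm h

theorem eq_or_eq (h : AtMostOnceEach i j [S]) : S = {i} ∨ S = {j} := by
  simpa [AtMostOnceEach, or_comm] using h

theorem eq_of_pair (hij : i ≠ j) (h : AtMostOnceEach i j [{i}, S]) : S = {j} := by
  simpa [AtMostOnceEach, List.cons_sublist_cons', hij] using h

theorem not_triple {U : Finset ι} : ¬ AtMostOnceEach i j [S, T, U] := by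
  rintro (h | h) <;> simpa using h.length_le

end AtMostOnceEach

namespace OracleTM

section OneQuery

variable {ι : Type} [DecidableEq ι] {M : OracleTM ι} {O : ι → Language Bool}
  {R : List (Finset ι) → Prop} {c : M.Cfg}

theorem Obedient.accepts_iff_reply (h : M.Obedient O R c) (hR : ∀ S T, ¬ R (c.log ++ [S] ++ [T])) :
    M.Accepts O c ↔ M.finalVerdict
      (M.reply (M.pause c) fun o => indicator (O o) ((M.pause c).query o)) = true := by
  cases hS : M.asks (M.pause c) with
  | none =>
    rw [reply_of_asks_eq_none hS, finalVerdict_pause]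
    exact h.accepts_iff_of_asks_eq_none hS
  | some S =>
    have hreply := h.pause.reply hS
    rw [← accepts_pause_iff, ← accepts_reply_iff hS]
    refine hreply.accepts_iff_of_asks_eq_none (Option.eq_none_iff_forall_ne_some.2 fun T hT => ?_)
    have hlog := hreply.log_asks hT
    rw [reply_log hS, pause_log] at hlog
    exact hR S T hlog

theorem Obedient.accepts_iff_verdictVia {j : ι} (h : M.Obedient O R c)
    (hj : ∀ S, R (c.log ++ [S]) → S = {j}) (hR : ∀ S T, ¬ R (c.log ++ [S] ++ [T])) :
    M.Accepts O c ↔ M.verdictVia j (O j) c = true := by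
  rw [verdictVia, verdictOn]
  split_ifs with hS
  · rw [h.accepts_iff_reply hR, reply_congr hS]
    simp
  · refine h.accepts_iff_of_asks_eq_none (Option.eq_none_iff_forall_ne_some.2 fun S hS' => hS ?_)
    rw [hS', hj S (h.log_asks hS')]

end OneQuery

section TwoQueries

variable {ι : Type} [DecidableEq ι] (M : OracleTM ι) (i j : ι) (D : Language Bool) (x : List Bool)

/-- Whether the answer to the question to `i` influences the verdict of `M` on `x`, if this is the
first question. For other machines the answer always counts as relevant. -/
noncomputable def answerMatters : Bool :=
  if M.asks (M.pause (M.init x)) = some {i} then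
    M.verdictVia j D (M.reply (M.pause (M.init x)) fun _ => true) ^^
      M.verdictVia j D (M.reply (M.pause (M.init x)) fun _ => false)
  else true

/-- The query of `M` to `i` on the input `x`, replaced by the empty word if its answer does not
matter. -/
noncomputable def adviceQuery : List Bool :=
  if M.answerMatters i j D x then M.relevantQuery i j D x else []

variable {M i j D x} {O : ι → Language Bool}

theorem answerMatters_eq_probeBit :
    M.answerMatters i j D x = M.probeBit true (M.probeBit false false i j D x) i j D x := by
  unfold answerMatters probeBit
  split_ifs <;> simp

theorem Obedient.accepts_iff_of_asks_first (hij : i ≠ j)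
    (h : M.Obedient O (AtMostOnceEach i j) (M.init x))
    (hi : M.asks (M.pause (M.init x)) = some {i}) :
    M.Accepts O (M.init x) ↔ M.verdictVia j (O j) (M.reply (M.pause (M.init x)) fun _ =>
      indicator (O i) ((M.pause (M.init x)).query i)) = true := by
  have hlog (a : ι → Bool) : (M.reply (M.pause (M.init x)) a).log = [{i}] := by
    rw [reply_log hi, pause_log]
    rfl
  have hreply :
      (M.reply (M.pause (M.init x)) fun _ => indicator (O i) ((M.pause (M.init x)).query i)) =
        M.reply (M.pause (M.init x)) fun o => indicator (O o) ((M.pause (M.init x)).query o) :=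
    reply_congr hi (by simp)
  rw [hreply, ← accepts_pause_iff, ← accepts_reply_iff hi]
  refine (h.pause.reply hi).accepts_iff_verdictVia (fun S hS => ?_) fun S T hST => ?_
  · rw [hlog] at hS
    exact hS.eq_of_pair hij
  · rw [hlog] at hST
    exact AtMostOnceEach.not_triple hST

-- If `v` is not constant, the value at a wrong guess `d` is the negation of the one at `e`.
theorem apply_eq_xor_guess (v : Bool → Bool) (d e : Bool) :
    v e = (v d ^^ ((if v true ^^ v false then e else d) ^^ d)) := by
  cases d <;> cases e <;> cases v true <;> cases v false <;> rfl

theorem Obedient.accepts_iff_combinedVerdict {C : Language Bool} (hij : i ≠ j) (hC : O i = C)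
    (h : M.Obedient O (AtMostOnceEach i j) (M.init x)) :
    M.Accepts O (M.init x) ↔ M.combinedVerdict (indicator C [])
      (indicator C (M.adviceQuery i j (O j) x)) i j (O j) x = true := by
  subst hC
  have hne : ({i} : Finset ι) ≠ {j} := by simpa using hij
  rw [combinedVerdict, adviceQuery, answerMatters, relevantQuery, queryOn]
  by_cases hi : M.asks (M.pause (M.init x)) = some {i}
  · simp only [hi, if_true, Option.some_inj, hne, if_false]
    rw [h.accepts_iff_of_asks_first hij hi]
    rw [apply_ite (indicator (O i)), ← apply_eq_xor_guess fun e =>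
      M.verdictVia j (O j) (M.reply (M.pause (M.init x)) fun _ => e)]
  by_cases hj : M.asks (M.pause (M.init x)) = some {j}
  · simp only [hj, if_true, Option.some_inj, hne.symm, if_false]
    exact Obedient.accepts_iff_of_asks_first hij.symm ⟨fun t => (h.1 t).symm, h.2⟩ hj
  · rw [if_neg hi, if_neg hj]
    refine h.accepts_iff_of_asks_eq_none (Option.eq_none_iff_forall_ne_some.2 fun S hS => ?_)
    rcases AtMostOnceEach.eq_or_eq (h.log_asks hS) with rfl | rfl
    · exact hi hS
    · exact hj hS

end TwoQueries

end OracleTM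

section Classes

open OracleTM Controller

variable {ι : Type} [DecidableEq ι] {M : OracleTM ι} {i j : ι} {𝒞 𝒟 : ComplexityClass}

theorem ClosedDownward.preimage_mem (hdown : ClosedDownward 𝒞 𝒟) {f : List Bool → List Bool}
    (hf : f ∈ FPOneQuery 𝒟) {B : Language Bool} (hB : B ∈ 𝒞) : {x : List Bool | f x ∈ B} ∈ 𝒞 :=
  hdown _ B ⟨f, hf, fun _ => Iff.rfl⟩ hB

theorem setOf_adviceQuery_mem (hdown : ClosedDownward 𝒞 𝒟) (hM : M.PolyTime) (hij : i ≠ j)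
    {C D : Language Bool} (hC : C ∈ 𝒞) (hD : D ∈ 𝒟) :
    {x : List Bool | M.adviceQuery i j D x ∈ C} ∈ 𝒞 := by
  have hprobe (e : Bool) := mem_FPOneQuery hM (ensures_probe hij e) hD
  have hextract := mem_FPOneQuery hM (ensures_extract hij) hD
  have hmem := hdown.preimage_mem (hprobe false)
    (hdown.preimage_mem (hprobe true) (hdown.preimage_mem hextract hC))
  convert hmem using 1
  refine Set.ext fun x => Eq.to_iff (congrArg (· ∈ C) ?_)
  simp [adviceQuery, answerMatters_eq_probeBit, input, probe]

theorem accepted_mem_PParallel (hdown : ClosedDownward 𝒞 𝒟) (hij : i ≠ j) (hM : M.PolyTime)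
    {O : ι → Language Bool} (hR : M.Obeys O (AtMostOnceEach i j)) (hC : O i ∈ 𝒞) (hD : O j ∈ 𝒟) :
    M.accepted O ∈ PParallel 𝒞 𝒟 := by
  set G : Language Bool := {x : List Bool | M.adviceQuery i j (O j) x ∈ O i}
  have hG : G ∈ 𝒞 := setOf_adviceQuery_mem hdown hM hij hC hD
  obtain ⟨hpoly, hspec⟩ := control_spec hM (R := fun l => l.length ≤ 1)
    (fun _ _ hl h => hl.length_le.trans h) (ensures_combine hij (indicator (O i) []))
  refine ⟨G, hG, O j, hD, _, hpoly, (hspec _).1, Eq.trans (Set.ext fun x => ?_) (hspec _).2⟩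
  exact (hM.obedient hR x).accepts_iff_combinedVerdict hij rfl

theorem accepted_mem_POrdered (hij : i ≠ j) (hι : ∀ o, o = i ∨ o = j) (hM : M.PolyTime)
    {O : ι → Language Bool} (hR : M.Obeys O fun l => l.length ≤ 1) (hC : O i ∈ 𝒞) (hD : O j ∈ 𝒟) :
    M.accepted O ∈ POrdered 𝒞 𝒟 := by
  obtain ⟨hpoly, hspec⟩ := control_spec hM (R := fun l => l.Sublist [{0}, {1}])
    (fun _ _ hl h => hl.sublist.trans h) (ensures_sequential (i := i) (j := j))
  refine ⟨O i, hC, O j, hD, _, hpoly, (hspec _).1, Eq.trans (Set.ext fun x => ?_) (hspec _).2⟩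
  have hanswers : (fun o => indicator (O o) ((M.pause (M.init x)).query o)) = fun o =>
      if o = i then indicator (O i) ((M.pause (M.init x)).query i)
      else indicator (O j) ((M.pause (M.init x)).query j) := by
    funext o
    rcases hι o with rfl | rfl <;> simp [hij.symm]
  have hx := (hM.obedient hR x).accepts_iff_reply fun _ _ => by simp
  rwa [hanswers] at hx

end Classes

end QueryOrder

open QueryOrder in
theorem corollaryc_general (𝒞 𝒟 : QueryOrder.ComplexityClass)
    (hdown : QueryOrder.ClosedDownward 𝒞 𝒟) :
    QueryOrder.PParallel 𝒞 𝒟 = QueryOrder.POrdered 𝒞 𝒟 ∧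
      QueryOrder.POrdered 𝒞 𝒟 = QueryOrder.POrdered 𝒟 𝒞 ∧
      QueryOrder.POrdered 𝒟 𝒞 = QueryOrder.PUnordered 𝒞 𝒟 := by
  have parallel_ordered : PParallel 𝒞 𝒟 ⊆ POrdered 𝒞 𝒟 := by
    rintro _ ⟨C, hC, D, hD, M, hM, hR, rfl⟩
    exact accepted_mem_POrdered (i := 0) (j := 1) (by decide) (by decide) hM hR hC hD
  have parallel_reversed : PParallel 𝒞 𝒟 ⊆ POrdered 𝒟 𝒞 := by
    rintro _ ⟨C, hC, D, hD, M, hM, hR, rfl⟩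
    exact accepted_mem_POrdered (i := 1) (j := 0) (by decide) (by decide) hM hR hD hC
  have ordered_unordered : POrdered 𝒞 𝒟 ⊆ PUnordered 𝒞 𝒟 := by
    rintro _ ⟨C, hC, D, hD, M, hM, hR, rfl⟩
    exact ⟨C, hC, D, hD, M, hM, fun x t => .inl (hR x t), rfl⟩
  have unordered_parallel : PUnordered 𝒞 𝒟 ⊆ PParallel 𝒞 𝒟 := by
    rintro _ ⟨C, hC, D, hD, M, hM, hR, rfl⟩
    exact accepted_mem_PParallel (i := 0) (j := 1) hdown (by decide) hM hR hC hD
  have reversed_parallel : POrdered 𝒟 𝒞 ⊆ PParallel 𝒞 𝒟 := by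
    rintro _ ⟨D, hD, C, hC, M, hM, hR, rfl⟩
    exact accepted_mem_PParallel (i := 1) (j := 0) hdown (by decide) hM
      (fun x t => .inr (hR x t)) hC hD
  have ordered_eq := parallel_ordered.antisymm (ordered_unordered.trans unordered_parallel)
  have reversed_eq := parallel_reversed.antisymm reversed_parallel
  have unordered_eq := (ordered_eq.le.trans ordered_unordered).antisymm unordered_parallel
  exact ⟨ordered_eq, ordered_eq.symm.trans reversed_eq, reversed_eq.symm.trans unordered_eq⟩

theorem corollaryc (𝒞 𝒟 : QueryOrder.ComplexityClass)
    (hdown : QueryOrder.ClosedDownward 𝒞 𝒟)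
    (hC : QueryOrder.ClosedDisjointUnion 𝒞)
    (hD : QueryOrder.ClosedDisjointUnion 𝒟) :
    QueryOrder.PParallel 𝒞 𝒟 = QueryOrder.POrdered 𝒞 𝒟 ∧
      QueryOrder.POrdered 𝒞 𝒟 = QueryOrder.POrdered 𝒟 𝒞 ∧
      QueryOrder.POrdered 𝒟 𝒞 = QueryOrder.PUnordered 𝒞 𝒟 :=
  corollaryc_general 𝒞 𝒟 hdown
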